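/- Let $p$ be an odd prime, $\mathbb{K}$ a CM number field and $\mathbb{K}_\infty/\mathbb{K}$ its cyclotomic $\mathbb{Z}_p$-extension, and assume that the primes of $\mathbb{K}$ above $p$ are totally ramified in $\mathbb{K}_\infty/\mathbb{K}$. Let $\mathbb{K}_n$ be the intermediate field of degree $p^n$ over $\mathbb{K}$, let $A_n$ be the $p$-part of the ideal class group of $\mathbb{K}_n$, and let $B_n \subset A_n$ be the $p$-part of the subgroup of the class group generated by the classes of the primes above $p$. Put $A = \varprojlim_n A_n$ and $B = \varprojlim_n B_n \subset A$ (projective limits with respect to the norm maps), and $A' = A/B$. Let $\tau$ be a topological generator of $\mathrm{Gal}(\mathbb{K}_\infty/\mathbb{K})$, let $T = \tau - 1$, let $\jmath$ be complex conjugation, and for $X = A, B, A'$ let $X^- = (1-\jmath)X$. The groups are written multiplicatively, so that $a^T = \tau(a)/a$. Put $$(A')^-(T) = \{x \in (A')^- : x^{T^m} = 1 \text{ for some } m > 0\}, \qquad (A')^-[T] = \{x \in (A')^- : x^T = 1\},$$ $$B' = \{\, a^T : a \in A^-,\ aB \in (A')^-[T] \,\}.$$ Suppose that $(A')^-(T)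 \neq \{1\}$. Then $B' \subset B^-$, the $\mathbb{Z}_p$-modules $B'$ and $(A')^-[T]$ are isomorphic, and the restriction of $T : A^- \to A^-$ gives a well-defined injective homomorphism of $\mathbb{Z}_p$-modules $\widehat{T} : (A')^-[T] \hookrightarrow B^-$, namely $\widehat{T}(aB) = a^T$ for every $a \in A^-$ with $aB \in (A')^-[T]$. -/

import Mathlib

open NumberField
open scoped nonZeroDivisors ComplexConjugate

namespace Iwasawa

section PPart

variable (p : ℕ) [Fact p.Prime]

/-- The `p`-part of an abelian group: the elements killed by a power of `p`. -/
abbrev PPart (G : Type*) [AddCommGroup G] : AddSubgroup G :=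
  AddCommGroup.primaryComponent G p

variable {G H J : Type*} [AddCommGroup G] [Finite G] [AddCommGroup H] [Finite H]
  [AddCommGroup J] [Finite J]

theorem PPart.pow_card_smul (x : PPart p G) : p ^ Nat.card G • x = 0 := by
  obtain ⟨x, k, hk⟩ := x
  apply Subtype.ext
  have h1 : addOrderOf x ∣ p ^ k := addOrderOf_dvd_of_nsmul_eq_zero hk
  obtain ⟨m, -, hm⟩ := (Nat.dvd_prime_pow (Fact.out : p.Prime)).1 h1
  have h2 : addOrderOf x ≤ Nat.card G := Nat.le_of_dvd Nat.card_pos (addOrderOf_dvd_natCard x)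
  have h3 : m ≤ Nat.card G :=
    (Nat.lt_pow_self (Fact.out : p.Prime).one_lt).le.trans (hm ▸ h2)
  exact addOrderOf_dvd_iff_nsmul_eq_zero.1 (hm ▸ pow_dvd_pow p h3)

/-- The `ℤ_p`-module structure of a finite abelian `p`-group: `z` acts as any integer congruent
to `z` modulo a power of `p` that kills the group. -/
noncomputable instance PPart.module : Module ℤ_[p] (PPart p G) :=
  letI : Module (ZMod (p ^ Nat.card G)) (PPart p G) :=
    AddCommGroup.zmodModule (PPart.pow_card_smul p)
  Module.compHom _ (PadicInt.toZModPow (p := p) (Nat.card G))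

theorem PPart.smul_def (z : ℤ_[p]) (x : PPart p G) :
    z • x = (PadicInt.toZModPow (p := p) (Nat.card G) z).val • x := by
  let _ : Module (ZMod (p ^ Nat.card G)) (PPart p G) :=
    AddCommGroup.zmodModule (PPart.pow_card_smul p)
  have : z • x = PadicInt.toZModPow (p := p) (Nat.card G) z • x := rfl
  rw [this]
  conv_lhs => rw [← ZMod.natCast_zmod_val (PadicInt.toZModPow (p := p) (Nat.card G) z)]
  rw [Nat.cast_smul_eq_nsmul]

theorem PPart.smul_eq {k : ℕ} (z : ℤ_[p]) (x : PPart p G) (hx : p ^ k • x = 0) :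
    z • x = (PadicInt.toZModPow (p := p) k z).val • x := by
  have key : ∀ m n : ℕ, m ≤ n → p ^ m • x = 0 →
      (PadicInt.toZModPow (p := p) n z).val • x = (PadicInt.toZModPow (p := p) m z).val • x := by
    intro m n hmn hm
    have h := PadicInt.cast_toZModPow (p := p) m n hmn z
    have h' : (PadicInt.toZModPow (p := p) n z).val ≡ (PadicInt.toZModPow (p := p) m z).val
        [MOD p ^ m] := by
      rw [← ZMod.natCast_eq_natCast_iff, ZMod.natCast_zmod_val, ← h, ZMod.cast_eq_val]
    have hd : addOrderOf x ∣ p ^ m := addOrderOf_dvd_of_nsmul_eq_zero hm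
    exact nsmul_eq_nsmul_iff_modEq.2 (h'.of_dvd hd)
  rw [PPart.smul_def]
  rcases le_total k (Nat.card G) with h | h
  · exact key _ _ h hx
  · exact (key _ _ h (PPart.pow_card_smul p x)).symm

/-- The `ℤ_p`-linear map induced on `p`-parts by a homomorphism of finite abelian groups. -/
noncomputable def PPart.map (f : G →+ H) : PPart p G →ₗ[ℤ_[p]] PPart p H where
  toFun x := ⟨f x, by
    obtain ⟨k, hk⟩ := x.2
    exact ⟨k, by rw [← map_nsmul, hk, map_zero]⟩⟩
  map_add' x y := Subtype.ext (map_add f _ _)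
  map_smul' z x := by
    obtain ⟨k, hk⟩ := x.2
    rw [RingHom.id_apply, PPart.smul_eq p (k := k) z x (Subtype.ext hk),
      PPart.smul_eq p (k := k) z _ (Subtype.ext (by
        change p ^ k • f x = 0
        rw [← map_nsmul, hk, map_zero]))]
    exact Subtype.ext (by simp)

@[simp]
theorem PPart.map_coe (f : G →+ H) (x : PPart p G) : (PPart.map p f x : H) = f x := rfl

end PPart

section ClassGroup

variable {R S : Type*} [CommRing R] [IsDedekindDomain R] [CommRing S] [IsDedekindDomain S]

/-- A multiplicative map of ideals that preserves nonzero ideals and principal ideals induces a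
homomorphism of class groups, which sends the class of `I` to the class of `φ I`. -/
noncomputable def classHom (φ : Ideal R →* Ideal S) (h0 : ∀ I, I ≠ ⊥ → φ I ≠ ⊥)
    (hp : ∀ x, ∃ y, φ (Ideal.span {x}) = Ideal.span {y}) : ClassGroup R →* ClassGroup S :=
  let ψ : (Ideal R)⁰ →* ClassGroup S :=
    ClassGroup.mk0.comp
      { toFun := fun I => ⟨φ (I : Ideal R), mem_nonZeroDivisors_iff_ne_zero.2
          (h0 I (mem_nonZeroDivisors_iff_ne_zero.1 I.2))⟩
        map_one' := Subtype.ext (map_one φ)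
        map_mul' := fun I J => Subtype.ext (map_mul φ (I : Ideal R) (J : Ideal R)) }
  have hψ : ∀ I J : (Ideal R)⁰, ClassGroup.mk0 I = ClassGroup.mk0 J → ψ I = ψ J := by
    intro I J h
    obtain ⟨x, y, hx, hy, hxy⟩ := ClassGroup.mk0_eq_mk0_iff.1 h
    obtain ⟨x', hx'⟩ := hp x
    obtain ⟨y', hy'⟩ := hp y
    refine ClassGroup.mk0_eq_mk0_iff.2 ⟨x', y', ?_, ?_, ?_⟩
    · rintro rfl
      exact h0 (Ideal.span {x}) (by simpa using hx) (by simpa using hx')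
    · rintro rfl
      exact h0 (Ideal.span {y}) (by simpa using hy) (by simpa using hy')
    · change Ideal.span {x'} * φ I = Ideal.span {y'} * φ J
      rw [← hx', ← hy', ← map_mul, ← map_mul, hxy]
  { toFun := fun c => ψ (ClassGroup.mk0_surjective c).choose
    map_one' := by
      rw [← map_one ψ]
      exact hψ _ _ ((ClassGroup.mk0_surjective _).choose_spec.trans (map_one _).symm)
    map_mul' := fun a b => by
      rw [← map_mul ψ]
      refine hψ _ _ ?_
      rw [map_mul, (ClassGroup.mk0_surjective (a * b)).choose_spec,
        (ClassGroup.mk0_surjective a).choose_spec, (ClassGroup.mk0_surjective b).choose_spec] }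

theorem classHom_mk0 (φ : Ideal R →* Ideal S) (h0 : ∀ I, I ≠ ⊥ → φ I ≠ ⊥)
    (hp : ∀ x, ∃ y, φ (Ideal.span {x}) = Ideal.span {y}) (I : (Ideal R)⁰) :
    classHom φ h0 hp (ClassGroup.mk0 I) =
      ClassGroup.mk0 ⟨φ I, mem_nonZeroDivisors_iff_ne_zero.2
          (h0 I (mem_nonZeroDivisors_iff_ne_zero.1 I.2))⟩ := by
  have h := (ClassGroup.mk0_surjective (ClassGroup.mk0 I)).choose_spec
  set J := (ClassGroup.mk0_surjective (ClassGroup.mk0 I)).choose with hJ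
  obtain ⟨x, y, hx, hy, hxy⟩ := ClassGroup.mk0_eq_mk0_iff.1 h
  obtain ⟨x', hx'⟩ := hp x
  obtain ⟨y', hy'⟩ := hp y
  refine ClassGroup.mk0_eq_mk0_iff.2 ⟨x', y', ?_, ?_, ?_⟩
  · rintro rfl
    exact h0 (Ideal.span {x}) (by simpa using hx) (by simpa using hx')
  · rintro rfl
    exact h0 (Ideal.span {y}) (by simpa using hy) (by simpa using hy')
  · change Ideal.span {x'} * φ J = Ideal.span {y'} * φ I
    rw [← hx', ← hy', ← map_mul, ← map_mul, hxy]

end ClassGroup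

section NumberFields

/-- The norm of ideal classes along an extension `E / F` of number fields. -/
noncomputable def classNorm (F E : Type*) [Field F] [NumberField F] [Field E] [NumberField E]
    [Algebra F E] : ClassGroup (𝓞 E) →* ClassGroup (𝓞 F) :=
  classHom (Ideal.relNorm (𝓞 F) : Ideal (𝓞 E) →*₀ Ideal (𝓞 F)).toMonoidHom
    (fun _ hI => by simpa using hI) (fun x => ⟨_, Ideal.relNorm_singleton (𝓞 F) x⟩)

/-- The map of ideal classes induced by an isomorphism of number fields. -/
noncomputable def classMap {F E : Type*} [Field F] [NumberField F] [Field E] [NumberField E]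
    (e : F ≃+* E) : ClassGroup (𝓞 F) →* ClassGroup (𝓞 E) :=
  classHom (Ideal.mapHom (RingOfIntegers.mapRingEquiv e)).toMonoidHom
    (fun I hI => by
      change Ideal.map _ I ≠ ⊥
      rwa [Ne, Ideal.map_eq_bot_iff_of_injective (RingOfIntegers.mapRingEquiv e).injective])
    (fun x => ⟨RingOfIntegers.mapRingEquiv e x, by
      change Ideal.map _ _ = _
      rw [Ideal.map_span, Set.image_singleton]⟩)

theorem intNorm_equiv {F E F' E' : Type*} [Field F] [NumberField F] [Field E] [NumberField E]
    [Field F'] [NumberField F'] [Field E'] [NumberField E'] [Algebra F E] [Algebra F' E']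
    (eF : F ≃+* F') (eE : E ≃+* E') (h : ∀ x, eE (algebraMap F E x) = algebraMap F' E' (eF x))
    (x : 𝓞 E) : Algebra.intNorm (𝓞 F') (𝓞 E') (RingOfIntegers.mapRingEquiv eE x) =
      RingOfIntegers.mapRingEquiv eF (Algebra.intNorm (𝓞 F) (𝓞 E) x) := by
  apply RingOfIntegers.coe_injective
  rw [Algebra.algebraMap_intNorm (K := F') (L := E')]
  change _ = eF (algebraMap (𝓞 F) F (Algebra.intNorm (𝓞 F) (𝓞 E) x))
  rw [Algebra.algebraMap_intNorm (K := F) (L := E),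
    Algebra.norm_eq_of_equiv_equiv eF eE (RingHom.ext fun x => (h x).symm)]
  rw [RingEquiv.apply_symm_apply]
  rfl

theorem classNorm_classMap {F E F' E' : Type*} [Field F] [NumberField F] [Field E] [NumberField E]
    [Field F'] [NumberField F'] [Field E'] [NumberField E'] [Algebra F E] [Algebra F' E']
    (eF : F ≃+* F') (eE : E ≃+* E') (h : ∀ x, eE (algebraMap F E x) = algebraMap F' E' (eF x))
    (c : ClassGroup (𝓞 E)) :
    classNorm F' E' (classMap eE c) = classMap eF (classNorm F E c) := by
  obtain ⟨I, rfl⟩ := ClassGroup.mk0_surjective c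
  rw [classNorm, classNorm, classMap, classMap, classHom_mk0, classHom_mk0, classHom_mk0,
    classHom_mk0]
  congr 1
  apply Subtype.ext
  change Ideal.relNorm (𝓞 F') (Ideal.map (RingOfIntegers.mapRingEquiv eE) (I : Ideal (𝓞 E))) =
    Ideal.map (RingOfIntegers.mapRingEquiv eF) (Ideal.relNorm (𝓞 F) (I : Ideal (𝓞 E)))
  rw [Ideal.relNorm_apply, Ideal.relNorm_apply, Ideal.map_span]
  congr 1
  ext y
  constructor
  · rintro ⟨x, hx, rfl⟩
    obtain ⟨z, hz, rfl⟩ := (Ideal.mem_map_of_equiv _ x).1 hx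
    exact ⟨_, ⟨z, hz, rfl⟩, (intNorm_equiv eF eE h z).symm⟩
  · rintro ⟨_, ⟨z, hz, rfl⟩, rfl⟩
    exact ⟨_, Ideal.mem_map_of_mem _ hz, intNorm_equiv eF eE h z⟩

/-- The subgroup of the class group generated by the classes of the prime ideals above `p`. -/
noncomputable def primeClasses (p : ℕ) (F : Type*) [Field F] [NumberField F] :
    Subgroup (ClassGroup (𝓞 F)) :=
  Subgroup.closure {c | ∃ P : (Ideal (𝓞 F))⁰, (P : Ideal (𝓞 F)).IsPrime ∧
    (p : 𝓞 F) ∈ (P : Ideal (𝓞 F)) ∧ ClassGroup.mk0 P = c}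

theorem classMap_mem_primeClasses (p : ℕ) {F E : Type*} [Field F] [NumberField F] [Field E]
    [NumberField E] (e : F ≃+* E) {c : ClassGroup (𝓞 F)} (hc : c ∈ primeClasses p F) :
    classMap e c ∈ primeClasses p E := by
  have : primeClasses p F ≤ (primeClasses p E).comap (classMap e) := by
    refine (Subgroup.closure_le _).2 ?_
    rintro _ ⟨P, hP, hp, rfl⟩
    refine Subgroup.subset_closure ⟨_, ?_, ?_, (classHom_mk0 _ _ _ P).symm⟩
    · exact Ideal.map_isPrime_of_equiv (RingOfIntegers.mapRingEquiv e)
    · have := Ideal.mem_map_of_mem (RingOfIntegers.mapRingEquiv e) hp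
      rwa [map_natCast] at this
  exact this hc

end NumberFields

section CyclotomicTower

/-- `L` is the cyclotomic `ℤ_p`-extension of `K`: it is a Galois extension of `K` with group
topologically isomorphic to `ℤ_p`, and it embeds over `K` into the field obtained from `K` by
adjoining all roots of unity of `p`-power order. -/
class IsCyclotomicZpExtension (p : ℕ) [Fact p.Prime] (K L : Type*) [Field K] [Field L]
    [Algebra K L] : Prop where
  isGalois : IsGalois K L
  nonempty_equiv : Nonempty (Gal(L/K) ≃ₜ* Multiplicative ℤ_[p])
  exists_algHom : ∃ f : L →ₐ[K] AlgebraicClosure K, ∀ x,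
    f x ∈ IntermediateField.adjoin K {ζ : AlgebraicClosure K | ∃ n : ℕ, ζ ^ p ^ n = 1}

section Layers

variable (p : ℕ) (K L : Type*) [Field K] [Field L] [Algebra K L]

/-- The `n`-th layer of the tower `L / K`: the field fixed by all `p ^ n`-th powers in
`Gal(L/K)`. When `Gal(L/K) ≅ ℤ_p`, it is the unique intermediate field of degree `p ^ n`
over `K`. -/
def layer (n : ℕ) : IntermediateField K L :=
  IntermediateField.fixedField
    (Subgroup.closure (Set.range fun σ : Gal(L/K) => σ ^ p ^ n))

variable {p K L} in
theorem mem_layer {n : ℕ} {x : L} :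
    x ∈ layer p K L n ↔ ∀ σ : Gal(L/K), (σ ^ p ^ n) x = x := by
  rw [layer, IntermediateField.mem_fixedField_iff]
  constructor
  · intro h σ
    exact h _ (Subgroup.subset_closure ⟨σ, rfl⟩)
  · intro h g hg
    have : Subgroup.closure (Set.range fun σ : Gal(L/K) => σ ^ p ^ n) ≤
        MulAction.stabilizer Gal(L/K) x := by
      refine (Subgroup.closure_le _).2 ?_
      rintro _ ⟨σ, rfl⟩
      exact h σ
    exact this hg

theorem layer_mono : Monotone (layer p K L) := by
  intro n m hnm x hx
  rw [mem_layer] at hx ⊢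
  intro σ
  have : σ ^ p ^ m = (σ ^ p ^ (m - n)) ^ p ^ n := by
    rw [← pow_mul, ← pow_add, Nat.sub_add_cancel hnm]
  rw [this]
  exact hx _

variable [Fact p.Prime] [IsCyclotomicZpExtension p K L]

instance layer_finiteDimensional (n : ℕ) : FiniteDimensional K (layer p K L n) := by
  have := IsCyclotomicZpExtension.isGalois p (K := K) (L := L)
  obtain ⟨e⟩ := IsCyclotomicZpExtension.nonempty_equiv (p := p) (K := K) (L := L)
  rw [← InfiniteGalois.isOpen_iff_finite]
  refine Subgroup.isOpen_of_mem_nhds (layer p K L n).fixingSubgroup (g := 1) ?_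
  let U : Set (Multiplicative ℤ_[p]) := {z | ‖Multiplicative.toAdd z‖ < (p : ℝ) ^ (-(n : ℤ))}
  have hU : IsOpen U := by
    have : IsOpen {z : ℤ_[p] | ‖z‖ < (p : ℝ) ^ (-(n : ℤ))} :=
      isOpen_lt continuous_norm continuous_const
    exact this
  have h1 : (1 : Multiplicative ℤ_[p]) ∈ U := by
    have : (0 : ℝ) < p := by exact_mod_cast (Fact.out : p.Prime).pos
    simp only [U, Set.mem_ofPred_eq, toAdd_one, norm_zero]
    positivity
  have hV : e ⁻¹' U ∈ nhds (1 : Gal(L/K)) :=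
    (hU.preimage e.continuous).mem_nhds (by simpa using h1)
  refine Filter.mem_of_superset hV ?_
  intro σ hσ
  have h2 : Multiplicative.toAdd (e σ) ∈ Ideal.span {(p : ℤ_[p]) ^ n} :=
    (PadicInt.norm_le_pow_iff_mem_span_pow _ n).1 (le_of_lt hσ)
  obtain ⟨z, hz⟩ := Ideal.mem_span_singleton'.1 h2
  have h3 : σ = (e.symm (Multiplicative.ofAdd z)) ^ p ^ n := by
    apply e.injective
    rw [map_pow]
    apply Multiplicative.toAdd.injective
    simp [← hz, mul_comm]
  refine (IntermediateField.mem_fixingSubgroup_iff _ _).2 fun x hx => ?_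
  rw [h3]
  exact mem_layer.1 hx _

theorem galois_mem_layer (τ : Gal(L/K)) (n : ℕ) (x : L) :
    x ∈ layer p K L n ↔ τ.toRingEquiv x ∈ layer p K L n := by
  obtain ⟨e⟩ := IsCyclotomicZpExtension.nonempty_equiv (p := p) (K := K) (L := L)
  have hcomm : ∀ σ : Gal(L/K), (σ ^ p ^ n) (τ x) = τ ((σ ^ p ^ n) x) := by
    intro σ
    have : σ ^ p ^ n * τ = τ * σ ^ p ^ n := e.injective (by rw [map_mul, map_mul, mul_comm])
    exact DFunLike.congr_fun this x
  rw [mem_layer, mem_layer]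
  change _ ↔ ∀ σ : Gal(L/K), (σ ^ p ^ n) (τ x) = τ x
  simp only [hcomm, EmbeddingLike.apply_eq_iff_eq]

instance layer_numberField [NumberField K] (n : ℕ) : NumberField (layer p K L n) :=
  NumberField.of_module_finite K (layer p K L n)

/-- The primes of `K` above `p` are totally ramified in `L / K`: at every layer such a prime becomes
the power of a single prime whose exponent is the degree of the layer. -/
def IsTotallyRamifiedAbove : Prop :=
  ∀ (n : ℕ) (𝔭 : Ideal (𝓞 K)), 𝔭.IsPrime → (p : 𝓞 K) ∈ 𝔭 →
    ∃ P : Ideal (𝓞 (layer p K L n)), P.IsPrime ∧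
      𝔭.map (algebraMap (𝓞 K) (𝓞 (layer p K L n))) = P ^ Module.finrank K (layer p K L n)

end Layers

section Conj

theorem exists_conj_aux (p : ℕ) [Fact p.Prime] (K : Type*) [Field K] [NumberField K]
    [IsCMField K] (x : AlgebraicClosure K)
    (hx : x ∈ IntermediateField.adjoin K {ζ : AlgebraicClosure K | ∃ n : ℕ, ζ ^ p ^ n = 1}) :
    ∃ y, ∀ φ : AlgebraicClosure K →+* ℂ, φ y = conj (φ x) := by
  have hp : ∀ n, p ^ n ≠ 0 := fun n => pow_ne_zero _ (Fact.out : p.Prime).ne_zero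
  induction hx using IntermediateField.adjoin_induction with
  | mem ζ h =>
    obtain ⟨n, hn⟩ := h
    refine ⟨ζ⁻¹, fun φ => ?_⟩
    have h1 : (φ ζ) ^ p ^ n = 1 := by rw [← map_pow, hn, map_one]
    rw [map_inv₀, Complex.inv_eq_conj (Complex.norm_eq_one_of_pow_eq_one h1 (hp n))]
  | algebraMap x =>
    exact ⟨algebraMap K _ (IsCMField.complexConj K x), fun φ =>
      IsCMField.complexEmbedding_complexConj K (φ.comp (algebraMap K _)) x⟩
  | add x y _ _ h1 h2 =>
    obtain ⟨a, ha⟩ := h1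
    obtain ⟨b, hb⟩ := h2
    exact ⟨a + b, fun φ => by simp [ha, hb]⟩
  | mul x y _ _ h1 h2 =>
    obtain ⟨a, ha⟩ := h1
    obtain ⟨b, hb⟩ := h2
    exact ⟨a * b, fun φ => by simp [ha, hb]⟩
  | inv x _ h1 =>
    obtain ⟨a, ha⟩ := h1
    exact ⟨a⁻¹, fun φ => by simp [ha]⟩

theorem nonempty_embedding (p : ℕ) [Fact p.Prime] (K L : Type*) [Field K] [NumberField K]
    [Field L] [Algebra K L] [IsCyclotomicZpExtension p K L] : Nonempty (L →+* ℂ) := by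
  have := IsCyclotomicZpExtension.isGalois p (K := K) (L := L)
  obtain ⟨φ⟩ := (inferInstance : Nonempty (K →+* ℂ))
  let _ := φ.toAlgebra
  exact ⟨(IsAlgClosed.lift : L →ₐ[K] ℂ).toRingHom⟩

theorem exists_conj (p : ℕ) [Fact p.Prime] (K L : Type*) [Field K] [NumberField K]
    [Field L] [Algebra K L] [IsCyclotomicZpExtension p K L]
    [IsCMField K] (x : L) : ∃ y : L, ∀ φ : L →+* ℂ, φ y = conj (φ x) := by
  have := IsCyclotomicZpExtension.isGalois p (K := K) (L := L)
  obtain ⟨f, hf⟩ := IsCyclotomicZpExtension.exists_algHom (p := p) (K := K) (L := L)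
  obtain ⟨y, hy⟩ := exists_conj_aux p K (f x) (hf x)
  let _ : Algebra L (AlgebraicClosure K) := f.toRingHom.toAlgebra
  have : IsScalarTower K L (AlgebraicClosure K) :=
    IsScalarTower.of_algebraMap_eq fun z => (f.commutes z).symm
  have : Algebra.IsAlgebraic L (AlgebraicClosure K) := Algebra.IsAlgebraic.tower_top (K := K) L
  have : CharZero L := charZero_of_injective_algebraMap (algebraMap K L).injective
  have : IsAlgClosure L (AlgebraicClosure K) := ⟨inferInstance, inferInstance⟩
  have : IsGalois L (AlgebraicClosure K) := inferInstance
  have hext : ∀ φ : L →+* ℂ, ∃ ψ : AlgebraicClosure K →+* ℂ, ∀ z, ψ (f z) = φ z := by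
    intro φ
    let _ := φ.toAlgebra
    let ψ : AlgebraicClosure K →ₐ[L] ℂ := IsAlgClosed.lift
    exact ⟨ψ.toRingHom, ψ.commutes⟩
  obtain ⟨φ₀⟩ := nonempty_embedding p K L
  obtain ⟨ψ₀, -⟩ := hext φ₀
  have hfix : ∀ g : AlgebraicClosure K ≃ₐ[L] AlgebraicClosure K, g y = y := by
    intro g
    apply ψ₀.injective
    have h1 := hy (ψ₀.comp (g : AlgebraicClosure K →+* AlgebraicClosure K))
    have h2 : g (f x) = f x := g.commutes x
    simp only [RingHom.comp_apply, RingHom.coe_coe, h2] at h1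
    rw [h1, hy]
  obtain ⟨z, hz⟩ := (InfiniteGalois.mem_range_algebraMap_iff_fixed (k := L) y).2 hfix
  refine ⟨z, fun φ => ?_⟩
  obtain ⟨ψ, hψ⟩ := hext φ
  rw [← hψ, ← hψ, ← hy ψ, ← hz]
  rfl

theorem exists_complexConj (p : ℕ) [Fact p.Prime] (K L : Type*) [Field K] [NumberField K]
    [Field L] [Algebra K L] [IsCyclotomicZpExtension p K L]
    [IsCMField K] :
    ∃ j : L ≃+* L, ∀ (φ : L →+* ℂ) (x : L), φ (j x) = conj (φ x) := by
  choose j hj using exists_conj p K L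
  obtain ⟨φ₀⟩ := nonempty_embedding p K L
  have hjj : ∀ x, j (j x) = x := fun x => φ₀.injective (by simp [hj])
  exact ⟨{ toFun := j
           invFun := j
           left_inv := hjj
           right_inv := hjj
           map_mul' := fun x y => φ₀.injective (by simp [hj])
           map_add' := fun x y => φ₀.injective (by simp [hj]) }, fun φ x => hj x φ⟩

/-- Complex conjugation on the cyclotomic `ℤ_p`-extension `L` of a CM field `K`: the automorphism
of `L` that is induced by complex conjugation under every embedding of `L` into `ℂ`. -/
noncomputable def complexConj (p : ℕ) [Fact p.Prime] (K L : Type*) [Field K] [NumberField K]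
    [Field L] [Algebra K L] [IsCyclotomicZpExtension p K L]
    [IsCMField K] : L ≃+* L := (exists_complexConj p K L).choose

theorem complexConj_spec (p : ℕ) [Fact p.Prime] (K L : Type*) [Field K] [NumberField K]
    [Field L] [Algebra K L] [IsCyclotomicZpExtension p K L]
    [IsCMField K] (φ : L →+* ℂ) (x : L) :
    φ (complexConj p K L x) = conj (φ x) :=
  (exists_complexConj p K L).choose_spec φ x

theorem complexConj_mem_layer (p : ℕ) [Fact p.Prime] (K L : Type*) [Field K] [NumberField K]
    [Field L] [Algebra K L] [IsCyclotomicZpExtension p K L]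
    [IsCMField K] (n : ℕ) (x : L) :
    x ∈ layer p K L n ↔ complexConj p K L x ∈ layer p K L n := by
  obtain ⟨φ₀⟩ := nonempty_embedding p K L
  have hcomm : ∀ (σ : Gal(L/K)) (x : L), σ (complexConj p K L x) = complexConj p K L (σ x) := by
    intro σ x
    apply φ₀.injective
    rw [complexConj_spec]
    exact complexConj_spec p K L (φ₀.comp (σ : L →+* L)) x
  rw [mem_layer, mem_layer]
  simp only [hcomm, EmbeddingLike.apply_eq_iff_eq]

end Conj

section Modules

variable (p : ℕ) [Fact p.Prime] (K L : Type*) [Field K] [NumberField K] [Field L] [Algebra K L]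
  [IsCyclotomicZpExtension p K L]

/-- The ideal class group of the `n`-th layer, written additively. -/
abbrev Cl (n : ℕ) : Type _ := Additive (ClassGroup (𝓞 (layer p K L n)))

/-- The norm map from the `p`-part of the class group of the `m`-th layer to that of the `n`-th
layer, for `n ≤ m`. -/
noncomputable def normMap {n m : ℕ} (h : n ≤ m) :
    PPart p (Cl p K L m) →ₗ[ℤ_[p]] PPart p (Cl p K L n) :=
  letI : Algebra (layer p K L n) (layer p K L m) :=
    (IntermediateField.inclusion (layer_mono p K L h)).toRingHom.toAlgebra
  PPart.map p (classNorm (layer p K L n) (layer p K L m)).toAdditive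

/-- `A`, the projective limit of the `p`-parts `A_n` of the class groups of the layers with
respect to the norm maps. -/
noncomputable def A : Submodule ℤ_[p] (∀ n, PPart p (Cl p K L n)) where
  carrier := {a | ∀ (n m : ℕ) (h : n ≤ m), normMap p K L h (a m) = a n}
  zero_mem' := fun n m h => map_zero _
  add_mem' := fun {a b} ha hb n m h => by
    rw [Pi.add_apply, Pi.add_apply, map_add, ha n m h, hb n m h]
  smul_mem' := fun z a ha n m h => by
    rw [Pi.smul_apply, Pi.smul_apply, map_smul, ha n m h]

/-- `B ⊆ A`, the projective limit of the `B_n`, where `B_n` is the `p`-part of the subgroup of the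
class group of the `n`-th layer that is generated by the classes of the primes above `p`. -/
noncomputable def B : Submodule ℤ_[p] (A p K L) where
  carrier := {a | ∀ n, Additive.toMul (a.1 n : Cl p K L n) ∈ primeClasses p (layer p K L n)}
  zero_mem' := fun n => one_mem _
  add_mem' := fun {a b} ha hb n => mul_mem (ha n) (hb n)
  smul_mem' := fun z a ha n => by
    change Additive.toMul ((z • a.1 n : PPart p (Cl p K L n)) : Cl p K L n) ∈ _
    rw [PPart.smul_def]
    exact pow_mem (ha n) _

/-- `A' = A / B`. -/
abbrev A' : Type _ := A p K L ⧸ B p K L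

variable {p K L} in
/-- The action on the `p`-part of the class group of the `n`-th layer of an automorphism of `L`
that preserves the layers. -/
noncomputable def actLayer (σ : L ≃+* L) (hσ : ∀ n x, x ∈ layer p K L n ↔ σ x ∈ layer p K L n)
    (n : ℕ) : PPart p (Cl p K L n) →ₗ[ℤ_[p]] PPart p (Cl p K L n) :=
  PPart.map p (classMap (σ.restrict (layer p K L n) (layer p K L n) (hσ n))).toAdditive

variable {p K L} in
theorem normMap_actLayer (σ : L ≃+* L)
    (hσ : ∀ n x, x ∈ layer p K L n ↔ σ x ∈ layer p K L n) {n m : ℕ} (h : n ≤ m)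
    (x : PPart p (Cl p K L m)) :
    normMap p K L h (actLayer σ hσ m x) = actLayer σ hσ n (normMap p K L h x) := by
  let _ : Algebra (layer p K L n) (layer p K L m) :=
    (IntermediateField.inclusion (layer_mono p K L h)).toRingHom.toAlgebra
  exact Subtype.ext (congrArg Additive.ofMul
    (classNorm_classMap (σ.restrict (layer p K L n) (layer p K L n) (hσ n))
      (σ.restrict (layer p K L m) (layer p K L m) (hσ m)) (fun _ => rfl)
      (Additive.toMul (x : Cl p K L m))))

variable {p K L} in
/-- The action on `A` of an automorphism of `L` that preserves the layers. -/
noncomputable def act (σ : L ≃+* L) (hσ : ∀ n x, x ∈ layer p K L n ↔ σ x ∈ layer p K L n) :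
    A p K L →ₗ[ℤ_[p]] A p K L :=
  LinearMap.restrict (LinearMap.pi fun n => actLayer σ hσ n ∘ₗ LinearMap.proj n)
    (fun a ha n m h => by
      change normMap p K L h (actLayer σ hσ m (a m)) = actLayer σ hσ n (a n)
      rw [normMap_actLayer, ha n m h])

variable {p K L} in
theorem act_mem_B (σ : L ≃+* L) (hσ : ∀ n x, x ∈ layer p K L n ↔ σ x ∈ layer p K L n)
    (a : A p K L) (ha : a ∈ B p K L) : act σ hσ a ∈ B p K L :=
  fun n => classMap_mem_primeClasses p _ (ha n)

variable {K L} in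
/-- `T = τ - 1`, acting on `A`. -/
noncomputable def T (τ : Gal(L/K)) : A p K L →ₗ[ℤ_[p]] A p K L :=
  act τ.toRingEquiv (galois_mem_layer p K L τ) - LinearMap.id

variable {K L} in
/-- `T = τ - 1`, acting on `A' = A / B`. -/
noncomputable def T' (τ : Gal(L/K)) : A' p K L →ₗ[ℤ_[p]] A' p K L :=
  (B p K L).mapQ (B p K L) (T p τ)
    (fun a ha => (B p K L).sub_mem (act_mem_B _ _ a ha) ha)

variable [IsCMField K]

/-- `1 - j`, acting on `A`, where `j` is complex conjugation. -/
noncomputable def oneSubConj : A p K L →ₗ[ℤ_[p]] A p K L :=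
  LinearMap.id - act (complexConj p K L) (complexConj_mem_layer p K L)

/-- `1 - j`, acting on `A' = A / B`, where `j` is complex conjugation. -/
noncomputable def oneSubConj' : A' p K L →ₗ[ℤ_[p]] A' p K L :=
  (B p K L).mapQ (B p K L) (oneSubConj p K L)
    (fun a ha => (B p K L).sub_mem ha (act_mem_B _ _ a ha))

/-- `A^- = (1 - j) A`. -/
noncomputable def AMinus : Submodule ℤ_[p] (A p K L) := LinearMap.range (oneSubConj p K L)

/-- `B^- = (1 - j) B`. -/
noncomputable def BMinus : Submodule ℤ_[p] (A p K L) := (B p K L).map (oneSubConj p K L)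

/-- `(A')^- = (1 - j) A'`. -/
noncomputable def A'Minus : Submodule ℤ_[p] (A' p K L) := LinearMap.range (oneSubConj' p K L)

variable {K L} in
/-- `(A')^-[T]`, the submodule of `(A')^-` killed by `T`. -/
noncomputable def A'MinusTorsion (τ : Gal(L/K)) : Submodule ℤ_[p] (A' p K L) :=
  A'Minus p K L ⊓ LinearMap.ker (T' p τ)

variable {K L} in
/-- `(A')^-(T)`, the submodule of `(A')^-` of all elements killed by some power of `T`. -/
noncomputable def A'MinusPart (τ : Gal(L/K)) : Submodule ℤ_[p] (A' p K L) :=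
  A'Minus p K L ⊓
    { carrier := {x | ∃ n : ℕ, (T' p τ ^ n) x = 0}
      zero_mem' := ⟨0, map_zero _⟩
      add_mem' := fun {x y} ⟨n, hn⟩ ⟨m, hm⟩ => ⟨n + m, by
        rw [map_add, Module.End.pow_map_zero_of_le (Nat.le_add_right n m) hn,
          Module.End.pow_map_zero_of_le (Nat.le_add_left m n) hm, add_zero]⟩
      smul_mem' := fun z x ⟨n, hn⟩ => ⟨n, by rw [map_smul, hn, smul_zero]⟩ }

variable {K L} in
/-- `B'`, the set of all `T a` with `a ∈ A^-` such that the class of `a` modulo `B` lies in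
`(A')^-[T]`. -/
noncomputable def B' (τ : Gal(L/K)) : Submodule ℤ_[p] (A p K L) :=
  (AMinus p K L ⊓ (A'MinusTorsion p τ).comap (B p K L).mkQ).map (T p τ)

end Modules

end CyclotomicTower

end Iwasawa

/-! Let `M` be the preimage of `(A')^-[T]` in `A^-`. Reduction modulo `B` maps `M` onto `(A')^-[T]`,
and `T` maps `M` onto `B'`. Everything follows once these two maps have the same kernel, that is,
once an element `a` of `M` satisfies `T a = 0` exactly when `a ∈ B`. The induced map is then
injective with image `B'`. It lands in `B^-` because `T a` lies in `B`, complex conjugation negates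
it, and 2 is invertible in `ℤ_p`.

`T` kills `B` because total ramification makes every prime above `p` in a layer Galois invariant
(`T_eq_zero_of_mem_B`).

The converse, `mem_B_of_T_eq_zero`, is an ambiguous class argument. In a layer `E` let `g` generate
`Gal(E/K)`, and let the class `c` satisfy `g c = c` and `j c = c⁻¹`. If `I` represents `c`, then `g
I` is `I` times an element whose norm to `K` is a unit. Dividing `I` by its conjugate gives an ideal
in `c²` whose multiplier `δ` has norm `u / j(u)` for a unit `u`. By Kronecker's theorem this norm is
a root of unity, and a power prime to `p` has `p`-power order. Such roots of unity in `K` are norms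
of units of `E`, since `E` is cut out of a `p`-power cyclotomic tower and `p` is odd. Hilbert 90 now
yields an invariant ideal in the class `c^(2w)`, with `w` prime to `p`. As `E/K` is unramified
outside `p`, that ideal is a product of primes above `p` and of an ideal extended from `K`.

The extended factor disappears in the limit: the norm from a higher layer raises it to a large power
of `p`, which kills its `p`-part because the class group of `K` is finite. What remains has order
prime to `p` and is removed by one more exponent (`exists_pow_eq_mul_of_classMap_eq`,
`classNorm_mk0_map`, `mk0_pow_card_eq_one`). -/

namespace Iwasawa

/-! ### Functoriality of the maps on ideal classes. -/

section ClassMaps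

theorem map_mapRingEquiv_ne_bot {F E : Type*} [Field F] [Field E] (e : F ≃+* E) {I : Ideal (𝓞 F)} (hI : I ≠ ⊥) :
    I.map (RingOfIntegers.mapRingEquiv e) ≠ ⊥ := by
  rwa [Ne, Ideal.map_eq_bot_iff_of_injective (RingOfIntegers.mapRingEquiv e).injective]

variable {F E D : Type*} [Field F] [NumberField F] [Field E] [NumberField E]
  [Field D] [NumberField D]

theorem classMap_mk0 (e : F ≃+* E) (I : (Ideal (𝓞 F))⁰) :
    classMap e (ClassGroup.mk0 I) =
      ClassGroup.mk0 ⟨(I : Ideal (𝓞 F)).map (RingOfIntegers.mapRingEquiv e),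
        mem_nonZeroDivisors_iff_ne_zero.2
          (map_mapRingEquiv_ne_bot e (mem_nonZeroDivisors_iff_ne_zero.1 I.2))⟩ :=
  classHom_mk0 _ _ _ _

theorem classNorm_mk0 [Algebra F E] (I : (Ideal (𝓞 E))⁰) :
    classNorm F E (ClassGroup.mk0 I) =
      ClassGroup.mk0 ⟨Ideal.relNorm (𝓞 F) (I : Ideal (𝓞 E)),
        mem_nonZeroDivisors_iff_ne_zero.2
          (by simpa using mem_nonZeroDivisors_iff_ne_zero.1 I.2)⟩ :=
  classHom_mk0 _ _ _ _

theorem classMap_trans (e : F ≃+* E) (f : E ≃+* D) (c : ClassGroup (𝓞 F)) :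
    classMap (e.trans f) c = classMap f (classMap e c) := by
  obtain ⟨I, rfl⟩ := ClassGroup.mk0_surjective c
  rw [classMap_mk0, classMap_mk0, classMap_mk0]
  congr 1
  apply Subtype.ext
  exact (Ideal.map_map (RingOfIntegers.mapRingEquiv e : 𝓞 F →+* 𝓞 E)
    (RingOfIntegers.mapRingEquiv f : 𝓞 E →+* 𝓞 D)).symm

theorem classMap_refl (c : ClassGroup (𝓞 F)) : classMap (RingEquiv.refl F) c = c := by
  obtain ⟨I, rfl⟩ := ClassGroup.mk0_surjective c
  rw [classMap_mk0]
  congr 1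
  apply Subtype.ext
  exact Ideal.map_id _

end ClassMaps

/-! ### Galois-invariant ideals. -/

section InvariantIdeals

open scoped Pointwise

theorem map_eq_prod_of_unramified {K E : Type*} [Field K] [Field E]
    [NumberField E] [Algebra K E] {q : Ideal (𝓞 K)} [q.IsMaximal] (hq : q ≠ ⊥)
    (hunram : ∀ P : Ideal (𝓞 E), P.IsPrime → P.LiesOver q → P.ramificationIdx (𝓞 K) = 1) :
    q.map (algebraMap (𝓞 K) (𝓞 E)) = ∏ P ∈ q.primesOver (𝓞 E), P := by
  rw [Ideal.map_algebraMap_eq_finsetProd_pow hq]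
  refine Finset.prod_congr rfl fun P hP => ?_
  rw [Set.mem_toFinset] at hP
  rw [hunram P hP.1 hP.2, pow_one]

variable {K E : Type*} [Field K] [NumberField K] [Field E] [NumberField E] [Algebra K E]

/-- An ideal invariant under a generator of the Galois group is a product of prime ideals above `p`
and of an ideal of the base field if the extension is unramified outside `p` and the primes
above `p` are invariant. -/
theorem exists_eq_mul_map_of_smul_eq [IsGalois K E] (p : ℕ) [Fact p.Prime] (g : Gal(E/K))
    (hg : ∀ x, x ∈ Subgroup.zpowers g)
    (hunram : ∀ (q : Ideal (𝓞 K)) (P : Ideal (𝓞 E)), q.IsPrime → q ≠ ⊥ → (p : 𝓞 K) ∉ q →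
      P.IsPrime → P.LiesOver q → P.ramificationIdx (𝓞 K) = 1)
    (hfix : ∀ P : Ideal (𝓞 E), P.IsPrime → (p : 𝓞 E) ∈ P → g • P = P)
    (X : Ideal (𝓞 E)) (hX : X ≠ ⊥) (hgX : g • X = X) :
    ∃ (Y : (Ideal (𝓞 E))⁰) (I : Ideal (𝓞 K)), I ≠ ⊥ ∧ ClassGroup.mk0 Y ∈ primeClasses p E ∧
      X = Y * I.map (algebraMap (𝓞 K) (𝓞 E)) := by
  have hsmul_mul : ∀ (s : Gal(E/K)) (I J : Ideal (𝓞 E)), s • (I * J) = s • I * s • J :=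
    fun s I J => Ideal.map_mul _ I J
  induction X using WellFoundedGT.induction with
  | ind X ih =>
    by_cases hXtop : X = ⊤
    · refine ⟨1, ⊤, top_ne_bot, ?_, ?_⟩
      · rw [map_one]
        exact one_mem _
      · simp [hXtop, Ideal.map_top, Ideal.one_eq_top]
    -- Noetherian induction: splitting off a proper invariant factor leaves a strictly larger
    -- invariant ideal.
    have step : ∀ Z W : Ideal (𝓞 E), X = Z * W → g • Z = Z → Z ≠ ⊤ →
        X < W ∧ W ≠ ⊥ ∧ g • W = W := by
      intro Z W hZW hZ hZt
      have hZ0 : Z ≠ ⊥ := by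
        rintro rfl
        exact hX (by rw [hZW, Ideal.bot_mul])
      have hW0 : W ≠ ⊥ := by
        rintro rfl
        exact hX (by rw [hZW, Ideal.mul_bot])
      refine ⟨lt_of_le_of_ne (hZW ▸ Ideal.mul_le_right) ?_, hW0, ?_⟩
      · intro h
        apply hZt
        rw [← Ideal.one_eq_top]
        apply mul_right_cancel₀ (b := W) (by simpa using hW0)
        rw [one_mul, ← hZW, h]
      · apply mul_left_cancel₀ (a := Z) (by simpa using hZ0)
        rw [← hZW, ← hgX, hZW, hsmul_mul, hZ]
    obtain ⟨P, hPmax, hXP⟩ := Ideal.exists_le_maximal X hXtop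
    have hPprime : P.IsPrime := hPmax.isPrime
    have hP0 : P ≠ ⊥ := fun h => hX (le_bot_iff.1 (h ▸ hXP))
    by_cases hpP : (p : 𝓞 E) ∈ P
    · obtain ⟨W, hW⟩ := Ideal.dvd_iff_le.2 hXP
      obtain ⟨h1, h2, h3⟩ := step P W hW (hfix P hPprime hpP) hPprime.ne_top
      obtain ⟨Y, I, hI, hY, h⟩ := ih W h1 h2 h3
      refine ⟨⟨P, mem_nonZeroDivisors_iff_ne_zero.2 hP0⟩ * Y, I, hI, ?_, ?_⟩
      · rw [map_mul]
        exact mul_mem (Subgroup.subset_closure ⟨_, hPprime, hpP, rfl⟩) hY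
      · rw [hW, h, Submonoid.coe_mul, mul_assoc]
    · let q : Ideal (𝓞 K) := P.under (𝓞 K)
      have hPq : P.LiesOver q := ⟨rfl⟩
      have hqprime : q.IsPrime := inferInstance
      have hq0 : q ≠ ⊥ := Ideal.IsIntegral.comap_ne_bot (𝓞 K) hP0
      have hpq : (p : 𝓞 K) ∉ q := by
        intro h
        apply hpP
        have : algebraMap (𝓞 K) (𝓞 E) (p : 𝓞 K) ∈ P := h
        rwa [map_natCast] at this
      have : q.IsMaximal := Ring.DimensionLEOne.maximalOfPrime hq0 hqprime
      have hqmap := map_eq_prod_of_unramified (E := E) hq0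
        (fun P' h1 h2 => hunram q P' hqprime hq0 hpq h1 h2)
      have hgz : ∀ s : Gal(E/K), s • X = X := by
        intro s
        have : Subgroup.zpowers g ≤ MulAction.stabilizer Gal(E/K) X :=
          (Subgroup.zpowers_le).2 hgX
        exact this (hg s)
      -- The primes over `q` are conjugate and `X` is invariant under the whole group, so all of
      -- them divide `X`. Each occurs only once in the extension of `q`.
      have hdvd : q.map (algebraMap (𝓞 K) (𝓞 E)) ∣ X := by
        rw [hqmap]
        refine Finset.prod_primes_dvd _ ?_ ?_
        · intro P' hP'
          rw [Set.mem_toFinset] at hP'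
          have := hP'.1
          have := hP'.2
          exact Ideal.prime_of_isPrime (Ideal.ne_bot_of_liesOver_of_ne_bot hq0 P') hP'.1
        · intro P' hP'
          rw [Set.mem_toFinset] at hP'
          have := hP'.1
          have := hP'.2
          obtain ⟨s, hs⟩ := Ideal.exists_smul_eq_of_isGaloisGroup q P P' Gal(E/K)
          rw [Ideal.dvd_iff_le, ← hs, ← hgz s]
          exact Ideal.map_mono hXP
      obtain ⟨W, hW⟩ := hdvd
      have hgq : g • q.map (algebraMap (𝓞 K) (𝓞 E)) = q.map (algebraMap (𝓞 K) (𝓞 E)) := by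
        change Ideal.map (MulSemiringAction.toRingHom Gal(E/K) (𝓞 E) g) _ = _
        rw [Ideal.map_map]
        congr 1
        ext x
        exact congrArg _ (smul_algebraMap g x)
      have hqt : q.map (algebraMap (𝓞 K) (𝓞 E)) ≠ ⊤ := fun h =>
        hPprime.ne_top (top_le_iff.1 (h ▸ Ideal.map_le_iff_le_comap.2 le_rfl))
      obtain ⟨h1, h2, h3⟩ := step _ W hW hgq hqt
      obtain ⟨Y, I, hI, hY, h⟩ := ih W h1 h2 h3
      refine ⟨Y, q * I, mul_ne_zero hq0 hI, hY, ?_⟩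
      rw [hW, h, Ideal.map_mul]
      ring

end InvariantIdeals

/-! ### Hilbert 90 and ambiguous classes in the minus part. -/

section AmbiguousClasses

/-- Hilbert's Theorem 90 for cyclic extensions, in any universe. -/
theorem exists_div_eq_of_norm_eq_one {K E : Type*} [Field K] [Field E] [Algebra K E]
    [FiniteDimensional K E] [IsGalois K E] {g : Gal(E/K)} (hg : ∀ x, x ∈ Subgroup.zpowers g)
    {x : E} (hx : Algebra.norm K x = 1) : ∃ y : Eˣ, y / g y = x := by
  classical
  -- These partial norms are the coefficients of the Lagrange resolvent `y = ∑ P i * g ^ i z`.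
  -- Applying `g` and multiplying by `x` shifts the index by one, and the sum closes up because the
  -- full norm is 1.
  let P : ℕ → E := fun i => ∏ k ∈ Finset.range i, (g ^ k) x
  have hP : ∀ i, x * g (P i) = P (i + 1) := by
    intro i
    simp only [P]
    rw [Finset.prod_range_succ', map_prod, pow_zero, AlgEquiv.one_apply, mul_comm]
    congr 1
    refine Finset.prod_congr rfl fun k _ => ?_
    rw [pow_succ', AlgEquiv.mul_apply]
  have hPn : P (orderOf g) = 1 := by
    have h := Algebra.norm_eq_prod_automorphisms K x
    rw [hx, map_one, ← IsCyclic.image_range_orderOf hg, Finset.prod_image] at h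
    · exact h.symm
    · intro a ha b hb
      exact pow_injOn_Iio_orderOf (by simpa using ha) (by simpa using hb)
  -- Dedekind's independence of characters: the coefficient `P 0 = 1` is nonzero.
  obtain ⟨z, hz⟩ : ∃ z, ∑ i ∈ Finset.range (orderOf g), P i * (g ^ i) z ≠ 0 := by
    by_contra! h
    have hli : LinearIndependent E fun i : Fin (orderOf g) => (⇑(g ^ (i : ℕ)) : E → E) :=
      (linearIndependent_monoidHom E E).comp
        (fun i : Fin (orderOf g) => ((g ^ (i : ℕ) : Gal(E/K)) : E →* E)) (fun a b hab =>
          Fin.ext (pow_injOn_Iio_orderOf a.2 b.2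
            (AlgEquiv.ext fun y => DFunLike.congr_fun hab y)))
    have h0 := Fintype.linearIndependent_iff.1 hli (fun i => P i) (by
      funext z
      rw [Finset.sum_apply, Pi.zero_apply, ← h z, Finset.sum_range]
      rfl) ⟨0, orderOf_pos g⟩
    simp [P] at h0
  refine ⟨Units.mk0 _ hz, ?_⟩
  have hxg : x * g (∑ i ∈ Finset.range (orderOf g), P i * (g ^ i) z) =
      ∑ i ∈ Finset.range (orderOf g), P i * (g ^ i) z := by
    have h1 : x * g (∑ i ∈ Finset.range (orderOf g), P i * (g ^ i) z) =
        ∑ i ∈ Finset.range (orderOf g), P (i + 1) * (g ^ (i + 1)) z := by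
      rw [map_sum, Finset.mul_sum]
      refine Finset.sum_congr rfl fun i _ => ?_
      rw [map_mul, ← mul_assoc, hP, pow_succ', AlgEquiv.mul_apply]
    have h2 := Finset.sum_range_succ (fun i => P i * (g ^ i) z) (orderOf g)
    rw [Finset.sum_range_succ', hPn, pow_orderOf_eq_one, pow_zero] at h2
    rw [h1]
    have h3 : P 0 = 1 := by simp [P]
    rw [h3] at h2
    exact add_right_cancel h2
  rw [Units.val_mk0, div_eq_iff ((map_ne_zero g).2 hz), hxg]

theorem exists_coprime_pow_pow_eq_one {M : Type*} [Monoid M] (p : ℕ) [Fact p.Prime] {u : M}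
    (hu : ∃ n, 0 < n ∧ u ^ n = 1) : ∃ w k : ℕ, p.Coprime w ∧ (u ^ w) ^ p ^ k = 1 := by
  obtain ⟨n, hn, h⟩ := hu
  obtain ⟨k, w, hw, rfl⟩ := Nat.exists_eq_pow_mul_and_not_dvd hn.ne' p (Fact.out : p.Prime).ne_one
  refine ⟨w, k, (Nat.Prime.coprime_iff_not_dvd Fact.out).2 hw, ?_⟩
  rw [← pow_mul, mul_comm, h]

variable {K E : Type*} [Field K] [NumberField K] [Field E] [NumberField E] [Algebra K E]

open scoped Pointwise

/-- Here `v = u / jK u`. It is an algebraic integer, and all its complex absolute values are 1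
because `jK` becomes complex conjugation under every embedding; Kronecker's theorem applies. -/
theorem exists_pow_eq_one_of_mul_conj_eq (jK : K ≃+* K)
    (hjK : ∀ (φ : K →+* ℂ) (x : K), φ (jK x) = conj (φ x)) (x y : 𝓞 K) (u : (𝓞 K)ˣ)
    (hx : x ≠ 0) (hxy : y = u * x) (v : K)
    (hv : v * (x * jK y) = y * jK x) : ∃ n, 0 < n ∧ v ^ n = 1 := by
  have hx' : (x : K) ≠ 0 := by simpa using hx
  have hy : (y : K) = (u : 𝓞 K) * x := by rw [hxy]; rfl
  have hjx : jK (x : K) ≠ 0 := by simpa using hx'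
  have hv' : v * jK ((u : 𝓞 K) : K) = ((u : 𝓞 K) : K) := by
    apply mul_right_cancel₀ (mul_ne_zero hx' hjx)
    rw [hy, map_mul] at hv
    linear_combination hv
  have hu0 : ((u : 𝓞 K) : K) ≠ 0 := by simp
  have hint : IsIntegral ℤ v := by
    have h1 : v = ((u : 𝓞 K) : K) * jK (((u⁻¹ : (𝓞 K)ˣ) : 𝓞 K) : K) := by
      have h2 : jK ((u : 𝓞 K) : K) * jK (((u⁻¹ : (𝓞 K)ˣ) : 𝓞 K) : K) = 1 := by
        rw [← map_mul, ← map_mul, Units.mul_inv, map_one, map_one]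
      linear_combination (-v) * h2 + jK (((u⁻¹ : (𝓞 K)ˣ) : 𝓞 K) : K) * hv'
    rw [h1]
    exact (RingOfIntegers.isIntegral_coe _).mul
      (RingOfIntegers.isIntegral_coe (RingOfIntegers.mapRingEquiv jK ((u⁻¹ : (𝓞 K)ˣ) : 𝓞 K)))
  obtain ⟨n, hn, h⟩ := NumberField.Embeddings.pow_eq_one_of_norm_eq_one K ℂ hint (fun φ => by
    have h3 := congrArg (fun z => ‖φ z‖) hv'
    simp only [map_mul, norm_mul, hjK, RCLike.norm_conj] at h3
    exact mul_right_cancel₀ (by simp) (h3.trans (one_mul _).symm))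
  exact ⟨n, hn, h⟩

/-- A class killed by `1 + j` and invariant under a generator of the Galois group is, up to an
exponent prime to `p`, a product of classes of primes above `p` and of a class that comes from the
base field. -/
theorem exists_pow_eq_mul_of_classMap_eq [IsGalois K E] (p : ℕ) [Fact p.Prime] (g : Gal(E/K))
    (hg : ∀ x, x ∈ Subgroup.zpowers g)
    (hunram : ∀ (q : Ideal (𝓞 K)) (P : Ideal (𝓞 E)), q.IsPrime → q ≠ ⊥ → (p : 𝓞 K) ∉ q →
      P.IsPrime → P.LiesOver q → P.ramificationIdx (𝓞 K) = 1)
    (hfix : ∀ P : Ideal (𝓞 E), P.IsPrime → (p : 𝓞 E) ∈ P → g • P = P)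
    (hroot : ∀ ζ : K, (∃ k : ℕ, ζ ^ p ^ k = 1) → ∃ α : (𝓞 E)ˣ, Algebra.norm K ((α : 𝓞 E) : E) = ζ)
    (jK : K ≃+* K) (hjK : ∀ (φ : K →+* ℂ) (x : K), φ (jK x) = conj (φ x))
    (j : E ≃+* E) (hjE : ∀ x, j (algebraMap K E x) = algebraMap K E (jK x))
    (hjg : ∀ x, j (g x) = g (j x)) (c : ClassGroup (𝓞 E))
    (hgc : classMap g.toRingEquiv c = c) (hjc : classMap j c = c⁻¹) :
    ∃ w : ℕ, p.Coprime w ∧ ∃ b ∈ primeClasses p E, ∃ (I : Ideal (𝓞 K)) (_ : I ≠ ⊥)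
      (M : (Ideal (𝓞 E))⁰), (M : Ideal (𝓞 E)) = I.map (algebraMap (𝓞 K) (𝓞 E)) ∧
      c ^ (2 * w) = b * ClassGroup.mk0 M := by
  have hsmul_mul : ∀ (s : Gal(E/K)) (I J : Ideal (𝓞 E)), s • (I * J) = s • I * s • J :=
    fun s I J => Ideal.map_mul _ I J
  have hsmul_pow : ∀ (s : Gal(E/K)) (I : Ideal (𝓞 E)) (n : ℕ), s • (I ^ n) = (s • I) ^ n :=
    fun s I n => Ideal.map_pow _ I n
  have hsmul_span : ∀ (s : Gal(E/K)) (x : 𝓞 E), s • Ideal.span {x} = Ideal.span {s • x} :=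
    fun s x => (Ideal.map_span _ _).trans (by rw [Set.image_singleton]; rfl)
  let J : 𝓞 E ≃+* 𝓞 E := RingOfIntegers.mapRingEquiv j
  have hJcomm : ∀ x : 𝓞 E, J (g • x) = g • J x := fun x => RingOfIntegers.ext (hjg x)
  obtain ⟨I, rfl⟩ := ClassGroup.mk0_surjective c
  have hI0 : (I : Ideal (𝓞 E)) ≠ ⊥ := mem_nonZeroDivisors_iff_ne_zero.1 I.2
  rw [classMap_mk0] at hgc hjc
  obtain ⟨x, y, hx, hy, hxy⟩ := ClassGroup.mk0_eq_mk0_iff.1 hgc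
  change Ideal.span {x} * (g • (I : Ideal (𝓞 E))) = Ideal.span {y} * (I : Ideal (𝓞 E)) at hxy
  set jI : Ideal (𝓞 E) := (I : Ideal (𝓞 E)).map J with hjI
  have hjI0 : jI ≠ ⊥ := map_mapRingEquiv_ne_bot j hI0
  have hjxy : Ideal.span {J x} * (g • jI) = Ideal.span {J y} * jI := by
    have h := congrArg (Ideal.map J) hxy
    rw [Ideal.map_mul, Ideal.map_mul, Ideal.map_span, Ideal.map_span, Set.image_singleton,
      Set.image_singleton] at h
    convert h using 2
    change Ideal.map (MulSemiringAction.toRingHom Gal(E/K) (𝓞 E) g)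
        (Ideal.map (J : 𝓞 E →+* 𝓞 E) I) = Ideal.map (J : 𝓞 E →+* 𝓞 E)
        (Ideal.map (MulSemiringAction.toRingHom Gal(E/K) (𝓞 E) g) I)
    rw [Ideal.map_map, Ideal.map_map]
    congr 1
    ext z
    exact congrArg _ (hJcomm z).symm
  have hJx : J x ≠ 0 := by simpa using hx
  have hJy : J y ≠ 0 := by simpa using hy
  set N : ℕ := Ideal.absNorm jI with hN
  have hN0 : N ≠ 0 := by
    rw [hN, Ne, Ideal.absNorm_eq_zero_iff]
    exact hjI0
  have hNE : (N : 𝓞 E) ≠ 0 := by exact_mod_cast hN0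
  -- `Q` is an integral ideal inverse to `jI` up to the rational factor `N`. It stands in for the
  -- fractional ideal `jI⁻¹`, so its class is `c` and `I * Q` lies in `c²`.
  obtain ⟨Q, hQ⟩ : jI ∣ Ideal.span {(N : 𝓞 E)} := by
    rw [Ideal.dvd_iff_le, Ideal.span_singleton_le_iff_mem]
    exact Ideal.absNorm_mem jI
  have hQ0 : Q ≠ ⊥ := by
    rintro rfl
    rw [Ideal.mul_bot, Ideal.span_singleton_eq_bot] at hQ
    exact hNE hQ
  have hgQ : g • jI * g • Q = jI * Q := by
    rw [← hsmul_mul, ← hQ, hsmul_span]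
    congr 2
    exact map_natCast (MulSemiringAction.toRingHom Gal(E/K) (𝓞 E) g) N
  have hQxy : Ideal.span {J y} * g • Q = Ideal.span {J x} * Q := by
    apply mul_left_cancel₀ (a := jI) (by simpa using hjI0)
    calc jI * (Ideal.span {J y} * g • Q) = (Ideal.span {J y} * jI) * g • Q := by ring
      _ = (Ideal.span {J x} * (g • jI)) * g • Q := by rw [hjxy]
      _ = Ideal.span {J x} * (g • jI * g • Q) := by ring
      _ = _ := by rw [hgQ]; ring
  have hQclass : ClassGroup.mk0 ⟨Q, mem_nonZeroDivisors_iff_ne_zero.2 hQ0⟩ =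
      ClassGroup.mk0 I := by
    have h1 : ClassGroup.mk0 ⟨jI, mem_nonZeroDivisors_iff_ne_zero.2 hjI0⟩ *
        ClassGroup.mk0 ⟨Q, mem_nonZeroDivisors_iff_ne_zero.2 hQ0⟩ = 1 := by
      rw [← map_mul, ClassGroup.mk0_eq_one_iff]
      change (jI * Q).IsPrincipal
      rw [← hQ]
      exact ⟨⟨_, rfl⟩⟩
    have h2 : ClassGroup.mk0 ⟨jI, mem_nonZeroDivisors_iff_ne_zero.2 hjI0⟩ =
      (ClassGroup.mk0 I)⁻¹ := hjc
    rw [h2, inv_mul_eq_one] at h1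
    exact h1.symm
  -- `I` and `g • I` have the same relative norm, which cancels.
  have hnorm : ∃ u : (𝓞 K)ˣ, RingOfIntegers.norm K y = u * RingOfIntegers.norm K x := by
    have hint : ∀ z : 𝓞 E, Algebra.intNorm (𝓞 K) (𝓞 E) z = RingOfIntegers.norm K z := fun z =>
      RingOfIntegers.ext (Algebra.algebraMap_intNorm (K := K) (L := E) z)
    have h := congrArg (Ideal.relNorm (𝓞 K)) hxy
    rw [map_mul, map_mul, Ideal.relNorm_singleton, Ideal.relNorm_singleton, Ideal.relNorm_smul,
      hint, hint] at h
    obtain ⟨u, hu⟩ := Ideal.span_singleton_eq_span_singleton.1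
      (mul_right_cancel₀ (by simpa using hI0) h)
    exact ⟨u, by rw [← hu, mul_comm]⟩
  obtain ⟨u, hu⟩ := hnorm
  have hnx : RingOfIntegers.norm K x ≠ 0 := by
    rw [Ne, RingOfIntegers.ext_iff, RingOfIntegers.coe_norm]
    exact fun h => hx (RingOfIntegers.ext (Algebra.norm_eq_zero_iff.1 h))
  have hδ0 : (x : E) * j y ≠ 0 := by
    have h1 : (x : E) ≠ 0 := by simpa using hx
    have h2 : (y : E) ≠ 0 := by simpa using hy
    simpa [h1] using h2
  -- `δ` is the factor by which `g` multiplies `I * Q`.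
  set δ : E := (y * j x) / (x * j y) with hδ
  have hnj : ∀ z : E, Algebra.norm K (j z) = jK (Algebra.norm K z) := by
    intro z
    rw [Algebra.norm_eq_of_equiv_equiv jK j (RingHom.ext fun x => (hjE x).symm) z,
      RingEquiv.apply_symm_apply]
  obtain ⟨w, k, hw, hwk⟩ := exists_coprime_pow_pow_eq_one p
    (exists_pow_eq_one_of_mul_conj_eq jK hjK _ _ u hnx hu (Algebra.norm K δ) (by
      change Algebra.norm K δ * (Algebra.norm K (x : E) * jK (Algebra.norm K (y : E))) =
        Algebra.norm K (y : E) * jK (Algebra.norm K (x : E))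
      rw [← hnj, ← hnj, ← map_mul, ← map_mul, ← map_mul, hδ, div_mul_cancel₀ _ hδ0]))
  obtain ⟨α, hα⟩ := hroot _ ⟨k, hwk⟩
  have hα0 : ((α : 𝓞 E) : E) ≠ 0 := by simp
  obtain ⟨β, hβ⟩ := exists_div_eq_of_norm_eq_one hg (x := δ ^ w / (α : 𝓞 E)) (by
    have h1 : Algebra.norm K (δ ^ w / (α : 𝓞 E)) * Algebra.norm K ((α : 𝓞 E) : E) =
        Algebra.norm K δ ^ w := by
      rw [← map_mul, div_mul_cancel₀ _ hα0, map_pow]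
    rw [hα] at h1
    refine mul_right_cancel₀ ?_ (h1.trans (one_mul _).symm)
    intro h
    rw [h, zero_pow (pow_ne_zero _ (Fact.out : p.Prime).ne_zero)] at hwk
    exact zero_ne_one hwk)
  obtain ⟨b, d, hd, hbd⟩ : ∃ (b : 𝓞 E) (d : ℤ), d ≠ 0 ∧ (b : E) = d * β := by
    have halg : IsAlgebraic ℤ (β : E) :=
      (IsFractionRing.isAlgebraic_iff ℤ ℚ E).2 (Algebra.IsAlgebraic.isAlgebraic (R := ℚ) (β : E))
    obtain ⟨d, hd, h⟩ := halg.exists_integral_multiple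
    exact ⟨⟨_, h⟩, d, hd, zsmul_eq_mul _ _⟩
  have hb0 : b ≠ 0 := by
    rintro rfl
    exact mul_ne_zero (Int.cast_ne_zero.2 hd) β.ne_zero hbd.symm
  -- The Hilbert 90 relation `δ ^ w * g β = α * β`, cleared of denominators. Since `α` is a unit, it
  -- disappears at the level of ideals and makes `X` below invariant.
  have hkey : (y * J x) ^ w * (g • b) = (α : 𝓞 E) * (b * (x * J y) ^ w) := by
    apply RingOfIntegers.ext
    simp only [map_mul, map_pow]
    change ((y : E) * j x) ^ w * g (b : E) = (α : 𝓞 E) * ((b : E) * ((x : E) * j y) ^ w)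
    have hgb : g (b : E) = d * g (β : E) := by rw [hbd, map_mul, map_intCast]
    have hgβ : g (β : E) ≠ 0 := by simp
    rw [hgb, hbd]
    rw [eq_div_iff hα0, div_mul_eq_mul_div, div_eq_iff hgβ, hδ, div_pow, div_mul_eq_mul_div,
      eq_div_iff (pow_ne_zero _ hδ0)] at hβ
    linear_combination (-(d : E)) * hβ
  set X : Ideal (𝓞 E) := Ideal.span {b} * ((I : Ideal (𝓞 E)) * Q) ^ w with hX
  have hX0 : X ≠ ⊥ := by
    refine mul_ne_zero (by simpa using hb0) (pow_ne_zero _ (mul_ne_zero hI0 hQ0))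
  have hIQ : Ideal.span {x * J y} * g • ((I : Ideal (𝓞 E)) * Q) =
      Ideal.span {y * J x} * ((I : Ideal (𝓞 E)) * Q) := by
    rw [hsmul_mul, ← Ideal.span_singleton_mul_span_singleton,
      ← Ideal.span_singleton_mul_span_singleton, mul_mul_mul_comm, hxy, hQxy, mul_mul_mul_comm]
  have hgX : g • X = X := by
    apply mul_left_cancel₀ (a := Ideal.span {x * J y} ^ w)
      (pow_ne_zero _ (by simpa using ⟨hx, hy⟩))
    calc Ideal.span {x * J y} ^ w * g • X
        = Ideal.span {g • b} * (Ideal.span {x * J y} * g • ((I : Ideal (𝓞 E)) * Q)) ^ w := by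
          rw [hX, hsmul_mul, hsmul_span, hsmul_pow]; ring
      _ = Ideal.span {(y * J x) ^ w * (g • b)} * ((I : Ideal (𝓞 E)) * Q) ^ w := by
          rw [hIQ, ← Ideal.span_singleton_mul_span_singleton ((y * J x) ^ w),
            ← Ideal.span_singleton_pow]
          ring
      _ = Ideal.span {x * J y} ^ w * X := by
          rw [hkey, ← Ideal.span_singleton_mul_span_singleton,
            ← Ideal.span_singleton_mul_span_singleton b, ← Ideal.span_singleton_pow,
            Ideal.span_singleton_eq_top.2 α.isUnit, ← Ideal.one_eq_top, hX]
          ring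
  obtain ⟨Y, I', hI', hY, hXY⟩ := exists_eq_mul_map_of_smul_eq p g hg hunram hfix X hX0 hgX
  have hM0 : I'.map (algebraMap (𝓞 K) (𝓞 E)) ≠ ⊥ := by
    intro h
    rw [h, Ideal.mul_bot] at hXY
    exact hX0 hXY
  refine ⟨w, hw, _, hY, I', hI', ⟨_, mem_nonZeroDivisors_iff_ne_zero.2 hM0⟩, rfl, ?_⟩
  rw [← map_mul]
  rw [pow_mul, pow_two]
  nth_rewrite 2 [← hQclass]
  rw [← map_mul, ← map_pow]
  refine ClassGroup.mk0_eq_mk0_iff.2 ⟨b, 1, hb0, one_ne_zero, ?_⟩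
  rw [Ideal.span_singleton_one, Ideal.top_mul]
  exact hXY

end AmbiguousClasses

/-! ### Galois groups of the layers. -/

section LayerGalois

variable (p : ℕ) [Fact p.Prime] (K L : Type*) [Field K] [Field L] [Algebra K L]
  [IsCyclotomicZpExtension p K L]

theorem galois_mul_comm (p : ℕ) [Fact p.Prime] (K L : Type*) [Field K] [Field L] [Algebra K L]
    [h : IsCyclotomicZpExtension p K L] (σ ρ : Gal(L/K)) : σ * ρ = ρ * σ := by
  obtain ⟨e⟩ := IsCyclotomicZpExtension.nonempty_equiv (p := p) (K := K) (L := L)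
  exact e.injective (by rw [map_mul, map_mul, mul_comm])

/-- `f` is reduction modulo `p ^ n` on `ℤ_p`. Its kernel consists of the `p ^ n`-th powers, and it
is closed, as the infinite Galois correspondence requires. -/
theorem exists_ker_eq_fixingSubgroup_layer (n : ℕ) :
    ∃ f : Gal(L/K) →* Multiplicative (ZMod (p ^ n)), Function.Surjective f ∧
      f.ker = (layer p K L n).fixingSubgroup := by
  have := IsCyclotomicZpExtension.isGalois p (K := K) (L := L)
  obtain ⟨e⟩ := IsCyclotomicZpExtension.nonempty_equiv (p := p) (K := K) (L := L)
  let f : Gal(L/K) →* Multiplicative (ZMod (p ^ n)) :=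
    (AddMonoidHom.toMultiplicative (PadicInt.toZModPow (p := p) n).toAddMonoidHom).comp
      e.toMulEquiv.toMonoidHom
  have hmem : ∀ σ, σ ∈ f.ker ↔ Multiplicative.toAdd (e σ) ∈ Ideal.span {(p : ℤ_[p]) ^ n} := by
    intro σ
    rw [← PadicInt.ker_toZModPow, MonoidHom.mem_ker, RingHom.mem_ker]
    exact Iff.rfl
  have hclosed : IsClosed (f.ker : Set Gal(L/K)) := by
    have h1 : IsClosed {z : ℤ_[p] | ‖z‖ ≤ (p : ℝ) ^ (-(n : ℤ))} :=
      isClosed_le continuous_norm continuous_const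
    have h2 : (f.ker : Set Gal(L/K)) =
        (fun σ => Multiplicative.toAdd (e σ)) ⁻¹' {z : ℤ_[p] | ‖z‖ ≤ (p : ℝ) ^ (-(n : ℤ))} := by
      ext σ
      rw [SetLike.mem_coe, hmem]
      exact (PadicInt.norm_le_pow_iff_mem_span_pow _ n).symm
    rw [h2]
    exact h1.preimage e.continuous
  have hker : Subgroup.closure (Set.range fun σ : Gal(L/K) => σ ^ p ^ n) = f.ker := by
    apply le_antisymm
    · refine (Subgroup.closure_le _).2 ?_
      rintro _ ⟨σ, rfl⟩
      rw [SetLike.mem_coe, hmem]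
      change Multiplicative.toAdd (e (σ ^ p ^ n)) ∈ _
      rw [map_pow, toAdd_pow, nsmul_eq_mul, Nat.cast_pow]
      exact Ideal.mul_mem_right _ _ (Ideal.mem_span_singleton_self _)
    · intro σ hσ
      rw [hmem] at hσ
      obtain ⟨z, hz⟩ := Ideal.mem_span_singleton'.1 hσ
      refine Subgroup.subset_closure ⟨e.symm (Multiplicative.ofAdd z), ?_⟩
      apply e.injective
      change e (e.symm (Multiplicative.ofAdd z) ^ p ^ n) = _
      rw [map_pow]
      apply Multiplicative.toAdd.injective
      simp [← hz, mul_comm]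
  refine ⟨f, ?_, ?_⟩
  · intro z
    obtain ⟨a, ha⟩ := ZMod.ringHom_surjective (PadicInt.toZModPow (p := p) n)
      (Multiplicative.toAdd z)
    exact ⟨e.symm (Multiplicative.ofAdd a), Multiplicative.toAdd.injective (by
      rw [← ha]
      change PadicInt.toZModPow n (Multiplicative.toAdd (e (e.symm (Multiplicative.ofAdd a)))) = _
      simp)⟩
  · rw [layer, hker]
    exact (InfiniteGalois.fixingSubgroup_fixedField ⟨f.ker, hclosed⟩).symm

theorem layer_isGalois (n : ℕ) : IsGalois K (layer p K L n) := by
  have := IsCyclotomicZpExtension.isGalois p (K := K) (L := L)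
  rw [← InfiniteGalois.normal_iff_isGalois]
  refine ⟨fun σ hσ ρ => ?_⟩
  rwa [galois_mul_comm p K L ρ σ, mul_inv_cancel_right]

theorem finrank_layer (n : ℕ) : Module.finrank K (layer p K L n) = p ^ n := by
  have := IsCyclotomicZpExtension.isGalois p (K := K) (L := L)
  have := layer_isGalois p K L n
  obtain ⟨f, hf, hker⟩ := exists_ker_eq_fixingSubgroup_layer p K L n
  have h1 := Subgroup.index_ker f
  have h2 := Subgroup.index_ker (AlgEquiv.restrictNormalHom (F := K) (K₁ := L) (layer p K L n))
  rw [IntermediateField.restrictNormalHom_ker, ← hker, h1,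
    MonoidHom.range_eq_top.2 hf,
    MonoidHom.range_eq_top.2 (AlgEquiv.restrictNormalHom_surjective L)] at h2
  rw [← IsGalois.card_aut_eq_finrank, ← Nat.card_congr Subgroup.topEquiv.toEquiv, ← h2,
    Nat.card_congr Subgroup.topEquiv.toEquiv, Nat.card_congr Multiplicative.toAdd, Nat.card_zmod]

variable {K L} in
-- The subgroup fixing a layer is open, so the dense powers of `τ` meet each of its cosets.
theorem mem_zpowers_restrictNormal {τ : Gal(L/K)}
    (hτ : (Subgroup.zpowers τ).topologicalClosure = ⊤) (n : ℕ) [Normal K (layer p K L n)]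
    (x : Gal(layer p K L n/K)) :
    x ∈ Subgroup.zpowers (AlgEquiv.restrictNormalHom (layer p K L n) τ) := by
  have := IsCyclotomicZpExtension.isGalois p (K := K) (L := L)
  obtain ⟨σ, rfl⟩ := AlgEquiv.restrictNormalHom_surjective (F := K) (K₁ := layer p K L n) L x
  have hopen : IsOpen ((layer p K L n).fixingSubgroup : Set Gal(L/K)) :=
    IntermediateField.fixingSubgroup_isOpen _
  have hσ : σ ∈ closure (Subgroup.zpowers τ : Set Gal(L/K)) := by
    rw [← Subgroup.topologicalClosure_coe, hτ]
    trivial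
  have hnhds : (fun ρ => σ⁻¹ * ρ) ⁻¹' ((layer p K L n).fixingSubgroup : Set Gal(L/K)) ∈ nhds σ :=
    (hopen.preimage (continuous_const_mul _)).mem_nhds (by simp)
  obtain ⟨ρ, hρ, k, rfl⟩ := mem_closure_iff_nhds.1 hσ _ hnhds
  refine ⟨k, ?_⟩
  have h1 : σ⁻¹ * τ ^ k ∈ (AlgEquiv.restrictNormalHom (F := K) (K₁ := L) (layer p K L n)).ker := by
    rw [IntermediateField.restrictNormalHom_ker]
    exact hρ
  rw [MonoidHom.mem_ker, map_mul, map_inv, inv_mul_eq_one, map_zpow] at h1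
  exact h1.symm

variable {K L} in
theorem restrict_eq_restrictNormal (τ : Gal(L/K)) (n : ℕ) [Normal K (layer p K L n)] :
    τ.toRingEquiv.restrict (layer p K L n) (layer p K L n) (galois_mem_layer p K L τ n) =
      (AlgEquiv.restrictNormalHom (layer p K L n) τ).toRingEquiv := by
  ext x
  exact (AlgEquiv.restrictNormal_commutes τ (layer p K L n) x).symm

end LayerGalois

/-! ### Ramification in extensions generated by a root of unity. -/

section Ramification

/-- The roots of `X ^ p ^ N - 1` stay distinct modulo a prime not containing `p`, so an inertia
element fixes `ζ` and is trivial. -/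
theorem ramificationIdx_eq_one_of_isPrimitiveRoot (p N : ℕ) [Fact p.Prime] {K M : Type*} [Field K]
    [NumberField K] [Field M] [NumberField M] [Algebra K M] [IsGalois K M] {ζ : M}
    (hζ : ζ ^ p ^ N = 1) (hgen : IntermediateField.adjoin K {ζ} = ⊤) (q : Ideal (𝓞 K))
    (Q : Ideal (𝓞 M)) [q.IsPrime] (hq : q ≠ ⊥) (hpq : (p : 𝓞 K) ∉ q) [Q.IsPrime] [Q.LiesOver q] :
    Q.ramificationIdx (𝓞 K) = 1 := by
  have : q.IsMaximal := Ring.DimensionLEOne.maximalOfPrime hq inferInstance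
  have : Finite (𝓞 K ⧸ q) := Ideal.finiteQuotientOfFreeOfNeBot q hq
  have : Finite q.ResidueField :=
    Finite.of_surjective _ q.bijective_algebraMap_quotient_residueField.2
  rw [← Ideal.ramificationIdxIn_eq_ramificationIdx q Q Gal(M/K),
    ← Ideal.card_inertia_eq_ramificationIdxIn (G := Gal(M/K)) q Q, Subgroup.card_eq_one,
    Subgroup.eq_bot_iff_forall]
  intro σ hσ
  have hpQ : (p : 𝓞 M) ∉ Q := by
    intro h
    apply hpq
    rw [Q.over_def q, Ideal.mem_comap, map_natCast]
    exact h
  have hζint : IsIntegral ℤ ζ := .of_pow (pow_pos (Fact.out : p.Prime).pos N) (by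
    rw [hζ]
    exact isIntegral_one)
  let z : 𝓞 M := ⟨ζ, hζint⟩
  have hz : z ^ p ^ N = 1 := RingOfIntegers.ext hζ
  have hσz : σ • z = z := by
    by_contra hne
    -- This is the quotient of `(σ z) ^ p ^ N - z ^ p ^ N = 0` by `σ z - z`. Modulo `Q` it becomes
    -- `p ^ N * z ^ (p ^ N - 1)`, which is not zero there.
    have h1 : ∑ i ∈ Finset.range (p ^ N), (σ • z) ^ i * z ^ (p ^ N - 1 - i) = 0 := by
      have h := geom_sum₂_mul (σ • z) z (p ^ N)
      rw [← smul_pow', hz, smul_one, sub_self] at h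
      exact (mul_eq_zero.1 h).resolve_right (sub_ne_zero.2 hne)
    have h2 : Ideal.Quotient.mk Q (σ • z) = Ideal.Quotient.mk Q z := Ideal.Quotient.eq.2 (hσ z)
    have h3 := congrArg (Ideal.Quotient.mk Q) h1
    simp only [map_sum, map_mul, map_pow, h2, geom_sum₂_self, map_zero] at h3
    rw [← map_pow, ← map_natCast (Ideal.Quotient.mk Q), ← map_mul,
      Ideal.Quotient.eq_zero_iff_mem] at h3
    rcases Ideal.IsPrime.mem_or_mem inferInstance h3 with h | h
    · rw [Nat.cast_pow] at h
      exact hpQ (Ideal.IsPrime.mem_of_pow_mem inferInstance _ h)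
    · have h4 := Ideal.mul_mem_right z Q h
      rw [pow_sub_one_mul (pow_ne_zero _ (Fact.out : p.Prime).ne_zero), hz] at h4
      exact Ideal.IsPrime.ne_top inferInstance ((Ideal.eq_top_iff_one Q).2 h4)
  have hσζ : σ ζ = ζ := congrArg (algebraMap (𝓞 M) M) hσz
  have hfix : (⊤ : IntermediateField K M) ≤
      IntermediateField.fixedField (Subgroup.zpowers σ) := by
    rw [← hgen, IntermediateField.adjoin_simple_le_iff, IntermediateField.mem_fixedField_iff]
    intro s hs
    have : Subgroup.zpowers σ ≤ MulAction.stabilizer Gal(M/K) ζ := Subgroup.zpowers_le.2 hσζ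
    exact this hs
  ext x
  exact (IntermediateField.mem_fixedField_iff _ _).1 (hfix trivial) σ (Subgroup.mem_zpowers σ)

end Ramification

/-! ### Subfields of cyclotomic extensions and roots of unity of `p`-power order. -/

section RootsOfUnity

open IntermediateField Polynomial

/-- A subgroup of order `d` fills out the solutions of `x ^ d = 1`, of which a cyclic group has at
most `d`. -/
theorem subgroup_eq_of_card_eq {G : Type*} [Group G] [Finite G] [IsCyclic G] {H H' : Subgroup G}
    (h : Nat.card H = Nat.card H') : H = H' := by
  classical
  have := Fintype.ofFinite G
  have key : ∀ J : Subgroup G, (J : Set G).toFinset =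
      Finset.univ.filter fun x : G => x ^ Nat.card J = 1 := by
    intro J
    refine Finset.eq_of_subset_of_card_le ?_ ?_
    · intro x hx
      rw [Set.mem_toFinset] at hx
      have h1 : (⟨x, hx⟩ : J) ^ Nat.card J = 1 := pow_card_eq_one'
      rw [Finset.mem_filter]
      exact ⟨Finset.mem_univ _, congrArg Subtype.val h1⟩
    · refine (IsCyclic.card_pow_eq_one_le Nat.card_pos).trans ?_
      rw [Set.toFinset_card, ← Nat.card_eq_fintype_card]
      exact le_rfl
  apply SetLike.coe_injective
  rw [← Set.toFinset_inj, key, key, h]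

theorem intermediateField_eq_of_finrank_eq {K M : Type*} [Field K] [Field M] [Algebra K M]
    [FiniteDimensional K M] [IsGalois K M] [IsCyclic Gal(M/K)] {F F' : IntermediateField K M}
    (h : Module.finrank K F = Module.finrank K F') : F = F' := by
  have h1 : Module.finrank F M = Module.finrank F' M := by
    apply Nat.eq_of_mul_eq_mul_left (Module.finrank_pos (R := K) (M := F))
    rw [Module.finrank_mul_finrank, h, Module.finrank_mul_finrank]
  rw [← IsGalois.fixedField_fixingSubgroup F, ← IsGalois.fixedField_fixingSubgroup F']
  congr 1
  apply subgroup_eq_of_card_eq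
  rw [IsGalois.card_fixingSubgroup_eq_finrank, IsGalois.card_fixingSubgroup_eq_finrank, h1]

variable {p : ℕ} [Fact p.Prime] {K Ω : Type*} [Field K] [Field Ω] [Algebra K Ω]

/-- For odd `p` the group `(ℤ/p^N)ˣ` is cyclic, hence so is the Galois group of `K⟮η⟯`, and the
degree determines a subfield. -/
theorem eq_of_le_adjoin_primitiveRoot (hp : p ≠ 2) {N : ℕ} {η : Ω} (hη : IsPrimitiveRoot η (p ^ N))
    [Algebra.IsAlgebraic K Ω] {F F' : IntermediateField K Ω} (hF : F ≤ K⟮η⟯) (hF' : F' ≤ K⟮η⟯)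
    (h : Module.finrank K F = Module.finrank K F') : F = F' := by
  have hpN : NeZero (p ^ N) := ⟨pow_ne_zero _ (Fact.out : p.Prime).ne_zero⟩
  have hcyc : IsCyclotomicExtension {p ^ N} K K⟮η⟯ :=
    hη.intermediateField_adjoin_isCyclotomicExtension K
  have : FiniteDimensional K K⟮η⟯ := IsCyclotomicExtension.finiteDimensional {p ^ N} K _
  have : IsGalois K K⟮η⟯ := IsCyclotomicExtension.isGalois {p ^ N} K _
  have : IsCyclic (ZMod (p ^ N))ˣ := ZMod.isCyclic_units_of_prime_pow p Fact.out hp N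
  have : IsCyclic Gal(K⟮η⟯/K) := isCyclic_of_injective _
    (IsPrimitiveRoot.autToPow_injective K
      (IsCyclotomicExtension.zeta_spec (p ^ N) K K⟮η⟯))
  rw [← lift_restrict hF, ← lift_restrict hF']
  congr 1
  apply intermediateField_eq_of_finrank_eq
  rw [← (restrictAlgEquiv hF).toLinearEquiv.finrank_eq,
    ← (restrictAlgEquiv hF').toLinearEquiv.finrank_eq, h]

theorem exists_forall_le_adjoin [CharZero K] (F : IntermediateField K Ω) [FiniteDimensional K F]
    (hF : F ≤ adjoin K {ζ : Ω | ∃ n : ℕ, ζ ^ p ^ n = 1}) :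
    ∃ N, ∀ N' ≥ N, ∀ η : Ω, IsPrimitiveRoot η (p ^ N') → F ≤ K⟮η⟯ := by
  obtain ⟨θ, hθ⟩ := Field.exists_primitive_element K F
  have hFθ : F = K⟮(θ : Ω)⟯ := by
    rw [← lift_adjoin_simple, hθ, lift_top]
  obtain ⟨S, hS, hθS⟩ := exists_finset_of_mem_adjoin (hF θ.2)
  have hN : ∃ N : ℕ, ∀ ζ ∈ S, ζ ^ p ^ N = 1 := by
    choose! k hk using fun ζ (h : ζ ∈ S) => hS h
    refine ⟨S.sup k, fun ζ hζ => ?_⟩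
    obtain ⟨c, hc⟩ := pow_dvd_pow p (Finset.le_sup (f := k) hζ)
    rw [hc, pow_mul, hk ζ hζ, one_pow]
  obtain ⟨N, hN⟩ := hN
  refine ⟨N, fun N' hN' η hη => ?_⟩
  have hpN : NeZero (p ^ N') := ⟨pow_ne_zero _ (Fact.out : p.Prime).ne_zero⟩
  rw [hFθ, adjoin_simple_le_iff]
  refine adjoin_le_iff.2 (fun ζ hζ => ?_) hθS
  obtain ⟨c, hc⟩ := pow_dvd_pow p hN'
  obtain ⟨i, -, rfl⟩ := hη.eq_pow_of_pow_eq_one (ξ := ζ) (by rw [hc, pow_mul, hN ζ hζ, one_pow])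
  exact pow_mem (mem_adjoin_simple_self K η) i

/-- The case `m = 0` must be excluded: there `ξ = 1`, and `η` could be 1 as well. -/
theorem isPrimitiveRoot_of_pow_eq {m n : ℕ} (hm : m ≠ 0) {R : Type*} [CommMonoid R] {ξ η : R}
    (hξ : IsPrimitiveRoot ξ (p ^ m)) (h : η ^ p ^ n = ξ) : IsPrimitiveRoot η (p ^ (m + n)) := by
  obtain ⟨m, rfl⟩ := Nat.exists_eq_succ_of_ne_zero hm
  have h1 : orderOf η = p ^ (m + n + 1) := by
    apply orderOf_eq_prime_pow
    · rw [add_comm, pow_add, pow_mul, h]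
      intro h2
      exact absurd ((Nat.pow_dvd_pow_iff_le_right (Fact.out : p.Prime).one_lt).1
        (hξ.dvd_of_pow_eq_one _ h2)) (by omega)
    · rw [show m + n + 1 = n + (m + 1) by omega, pow_add, pow_mul, h]
      exact hξ.pow_eq_one
  rw [show m.succ + n = m + n + 1 by omega, ← h1]
  exact IsPrimitiveRoot.orderOf η

/-- A subfield of degree `p ^ n` of the field generated by the roots of unity of `p`-power order
contains a `p ^ n`-th root of every primitive root of unity of maximal `p`-power order in `K`. -/
theorem exists_mem_pow_eq [CharZero K] [IsAlgClosure K Ω] (hp : p ≠ 2) {m n : ℕ} (hm : m ≠ 0) {ξ : K}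
    (hξ : IsPrimitiveRoot ξ (p ^ m)) (hmax : ∀ b : K, ¬ IsPrimitiveRoot b (p ^ (m + 1)))
    (F : IntermediateField K Ω) (hFn : Module.finrank K F = p ^ n)
    (hF : F ≤ adjoin K {ζ : Ω | ∃ n : ℕ, ζ ^ p ^ n = 1}) :
    ∃ η ∈ F, minpoly K η = X ^ p ^ n - C ξ := by
  have : IsAlgClosed Ω := IsAlgClosure.isAlgClosed K
  have : Algebra.IsAlgebraic K Ω := IsAlgClosure.isAlgebraic
  have hpos : ∀ k, 0 < p ^ k := fun k => pow_pos (Fact.out : p.Prime).pos k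
  have : FiniteDimensional K F := Module.finite_of_finrank_pos (by rw [hFn]; exact hpos n)
  have hξ' : IsPrimitiveRoot (algebraMap K Ω ξ) (p ^ m) :=
    hξ.map_of_injective (algebraMap K Ω).injective
  obtain ⟨η, hη⟩ := IsAlgClosed.exists_pow_nat_eq (algebraMap K Ω ξ) (hpos n)
  -- For odd `p` it suffices that `ξ` is not a `p`-th power, and a `p`-th root of `ξ` would
  -- contradict maximality.
  have hirr : Irreducible (X ^ p ^ n - C ξ) :=
    X_pow_sub_C_irreducible_of_prime_pow Fact.out hp n fun b hb => hmax b
      (isPrimitiveRoot_of_pow_eq hm hξ (by rwa [pow_one]))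
  have hmin : minpoly K η = X ^ p ^ n - C ξ :=
    (minpoly.eq_of_irreducible_of_monic hirr (by simp [hη])
      (monic_X_pow_sub_C ξ (hpos n).ne')).symm
  refine ⟨η, ?_, hmin⟩
  obtain ⟨N, hN⟩ := exists_forall_le_adjoin F hF
  obtain ⟨η', hη'⟩ := IsAlgClosed.exists_pow_nat_eq η (hpos N)
  have hηprim := isPrimitiveRoot_of_pow_eq hm hξ' hη
  have hη'prim := isPrimitiveRoot_of_pow_eq (by omega) hηprim hη'
  have hle : K⟮η⟯ ≤ K⟮η'⟯ := by
    rw [adjoin_simple_le_iff, ← hη']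
    exact pow_mem (mem_adjoin_simple_self K η') _
  have hfin : Module.finrank K K⟮η⟯ = p ^ n := by
    rw [adjoin.finrank (Algebra.IsIntegral.isIntegral η), hmin, natDegree_X_pow_sub_C]
  -- `F` and `K⟮η⟯` have the same degree inside `K⟮η'⟯`, so they coincide.
  rw [eq_of_le_adjoin_primitiveRoot hp hη'prim (hN _ (by omega) η' hη'prim) hle
    (hFn.trans hfin.symm)]
  exact mem_adjoin_simple_self K η

/-- By degrees `α` generates `E`, so its norm is `(-1) ^ p ^ n * (-ξ)`; the sign is right because
`p` is odd. -/
theorem norm_eq_of_minpoly_eq {E : Type*} [Field E] [Algebra K E] (hp : p ≠ 2) {n : ℕ}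
    (hE : Module.finrank K E = p ^ n) {ξ : K} {α : E} (hα : minpoly K α = X ^ p ^ n - C ξ) :
    Algebra.norm K α = ξ := by
  have hpos : 0 < p ^ n := pow_pos (Fact.out : p.Prime).pos n
  have : FiniteDimensional K E := Module.finite_of_finrank_pos (by rw [hE]; exact hpos)
  have hint : IsIntegral K α := Algebra.IsIntegral.isIntegral α
  have h1 : Module.finrank K K⟮α⟯ = p ^ n := by
    rw [adjoin.finrank hint, hα, natDegree_X_pow_sub_C]
  have h2 : Module.finrank K⟮α⟯ E = 1 := by
    apply Nat.eq_of_mul_eq_mul_left (h1 ▸ hpos : 0 < Module.finrank K K⟮α⟯)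
    rw [Module.finrank_mul_finrank, h1, hE, mul_one]
  rw [Algebra.norm_eq_norm_adjoin, h2, pow_one, ← adjoin.powerBasis_gen hint,
    Algebra.PowerBasis.norm_gen_eq_coeff_zero_minpoly, adjoin.powerBasis_gen, minpoly_gen, hα,
    adjoin.powerBasis_dim, hα, natDegree_X_pow_sub_C]
  have hodd : Odd (p ^ n) := ((Fact.out : p.Prime).odd_of_ne_two hp).pow
  simp [hodd.neg_one_pow, hpos.ne]

theorem exists_maximal_primitiveRoot (p : ℕ) [Fact p.Prime] (K : Type*) [Field K] [NumberField K] :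
    ∃ (m : ℕ) (ξ : K), IsPrimitiveRoot ξ (p ^ m) ∧
      ∀ b : K, ¬ IsPrimitiveRoot b (p ^ (m + 1)) := by
  have hbound : ∀ (k : ℕ) (b : K), IsPrimitiveRoot b (p ^ k) → p ^ k ≤ Units.torsionOrder K := by
    intro k b hb
    have : NeZero (p ^ k) := ⟨pow_ne_zero _ (Fact.out : p.Prime).ne_zero⟩
    exact Nat.le_of_dvd (Units.torsionOrder_pos K) (Units.dvd_torsionOrder_of_isPrimitiveRoot hb)
  by_contra! h
  have hall : ∀ m : ℕ, ∃ ξ : K, IsPrimitiveRoot ξ (p ^ m) := by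
    intro m
    induction m with
    | zero => exact ⟨1, by simp⟩
    | succ m ih =>
      obtain ⟨ξ, hξ⟩ := ih
      exact h m ξ hξ
  obtain ⟨ξ, hξ⟩ := hall (Units.torsionOrder K)
  exact absurd (hbound _ ξ hξ) (not_le.2 (Nat.lt_pow_self (Fact.out : p.Prime).one_lt))

theorem exists_eq_pow_of_maximal {m : ℕ} {ξ : K} (hξ : IsPrimitiveRoot ξ (p ^ m))
    (hmax : ∀ b : K, ¬ IsPrimitiveRoot b (p ^ (m + 1))) {ζ : K} (hζ : ∃ k : ℕ, ζ ^ p ^ k = 1) :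
    ∃ i : ℕ, ξ ^ i = ζ := by
  have hpm : NeZero (p ^ m) := ⟨pow_ne_zero _ (Fact.out : p.Prime).ne_zero⟩
  obtain ⟨k, hk⟩ := hζ
  obtain ⟨i, -, hi⟩ := (Nat.dvd_prime_pow (Fact.out : p.Prime)).1 (orderOf_dvd_of_pow_eq_one hk)
  have hprim : IsPrimitiveRoot ζ (p ^ i) := hi ▸ IsPrimitiveRoot.orderOf ζ
  have him : i ≤ m := by
    by_contra! h
    exact hmax _ (hprim.pow (pow_pos (Fact.out : p.Prime).pos i)
      (show p ^ i = p ^ (i - (m + 1)) * p ^ (m + 1) by rw [← pow_add]; congr 1; omega))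
  obtain ⟨c, hc⟩ := pow_dvd_pow p him
  obtain ⟨j, -, hj⟩ := hξ.eq_pow_of_pow_eq_one (ξ := ζ) (by
    rw [hc, pow_mul, hprim.pow_eq_one, one_pow])
  exact ⟨j, hj⟩

end RootsOfUnity

/-! ### Arithmetic of the layers inside the cyclotomic tower. -/

section LayerCyclotomic

open IntermediateField Polynomial

variable (p : ℕ) [Fact p.Prime] (K L : Type*) [Field K] [NumberField K] [Field L] [Algebra K L]
  [IsCyclotomicZpExtension p K L]

theorem exists_algHom_map_layer_le (p : ℕ) [Fact p.Prime] (K L : Type*) [Field K] [Field L]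
    [Algebra K L] [IsCyclotomicZpExtension p K L] :
    ∃ f : L →ₐ[K] AlgebraicClosure K, ∀ n, (layer p K L n).map f ≤
      adjoin K {ζ : AlgebraicClosure K | ∃ n : ℕ, ζ ^ p ^ n = 1} := by
  obtain ⟨f, hf⟩ := IsCyclotomicZpExtension.exists_algHom (p := p) (K := K) (L := L)
  refine ⟨f, fun n => ?_⟩
  rintro _ ⟨x, -, rfl⟩
  exact hf x

/-- It is enough to treat a generator `ξ` of the `p`-power roots of unity of `K`. The layer contains
a `p ^ n`-th root of `ξ`, which is itself a root of unity and has norm `ξ`. If `ξ = 1` there is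
nothing to do. -/
theorem exists_units_norm_eq (hp : p ≠ 2) (n : ℕ) {ζ : K} (hζ : ∃ k : ℕ, ζ ^ p ^ k = 1) :
    ∃ α : (𝓞 (layer p K L n))ˣ, Algebra.norm K ((α : 𝓞 (layer p K L n)) : layer p K L n) = ζ := by
  obtain ⟨m, ξ, hξ, hmax⟩ := exists_maximal_primitiveRoot p K
  obtain ⟨i, rfl⟩ := exists_eq_pow_of_maximal hξ hmax hζ
  by_cases hm : m = 0
  · subst hm
    rw [pow_zero, IsPrimitiveRoot.one_right_iff] at hξ
    exact ⟨1, by simp [hξ]⟩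
  obtain ⟨f, hf⟩ := exists_algHom_map_layer_le p K L
  have hrank : Module.finrank K ((layer p K L n).map f) = p ^ n := by
    rw [← finrank_layer p K L n]
    exact (equivMap (layer p K L n) f).toLinearEquiv.finrank_eq.symm
  obtain ⟨_, ⟨x, hx, rfl⟩, hmin⟩ := exists_mem_pow_eq hp hm hξ hmax _ hrank (hf n)
  let α : layer p K L n := ⟨x, hx⟩
  have hα : minpoly K α = X ^ p ^ n - C ξ := by
    rw [← hmin]
    exact (minpoly.algHom_eq (f.comp (layer p K L n).val) (RingHom.injective _) α).symm
  have hαξ : α ^ p ^ n = algebraMap K _ ξ := by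
    have h := minpoly.aeval K α
    rwa [hα, map_sub, map_pow, aeval_X, aeval_C, sub_eq_zero] at h
  have hα1 : α ^ p ^ (n + m) = 1 := by
    rw [pow_add, pow_mul, hαξ, ← map_pow, hξ.pow_eq_one, map_one]
  have hne : p ^ (n + m) ≠ 0 := pow_ne_zero _ (Fact.out : p.Prime).ne_zero
  have hint : IsIntegral ℤ α := .of_pow (Nat.pos_of_ne_zero hne) (by
    rw [hα1]
    exact isIntegral_one)
  let u : (𝓞 (layer p K L n))ˣ := Units.ofPowEqOne ⟨α, hint⟩ _ (RingOfIntegers.ext hα1) hne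
  refine ⟨u ^ i, ?_⟩
  rw [Units.val_pow_eq_pow_val]
  change Algebra.norm K (α ^ i) = ξ ^ i
  rw [map_pow]
  congr 1
  exact norm_eq_of_minpoly_eq hp (finrank_layer p K L n) hα

/-- The layer embeds in some `K⟮η⟯` with `η` a root of unity of `p`-power order, and ramification
indices divide those of a larger field. -/
theorem layer_ramificationIdx_eq_one (n : ℕ) (q : Ideal (𝓞 K)) (P : Ideal (𝓞 (layer p K L n)))
    [q.IsPrime] (hq : q ≠ ⊥) (hpq : (p : 𝓞 K) ∉ q) [P.IsPrime] [P.LiesOver q] :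
    P.ramificationIdx (𝓞 K) = 1 := by
  obtain ⟨f, hf⟩ := exists_algHom_map_layer_le p K L
  have : FiniteDimensional K ((layer p K L n).map f) :=
    (equivMap (layer p K L n) f).toLinearEquiv.finiteDimensional
  obtain ⟨N, hN⟩ := exists_forall_le_adjoin _ (hf n)
  have hpN : NeZero (p ^ N) := ⟨pow_ne_zero _ (Fact.out : p.Prime).ne_zero⟩
  have : NeZero ((p ^ N : ℕ) : AlgebraicClosure K) := NeZero.charZero
  obtain ⟨η, hη⟩ := HasEnoughRootsOfUnity.exists_primitiveRoot (AlgebraicClosure K) (p ^ N)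
  have hle := hN N le_rfl η hη
  have hcyc : IsCyclotomicExtension {p ^ N} K K⟮η⟯ :=
    hη.intermediateField_adjoin_isCyclotomicExtension K
  have : FiniteDimensional K K⟮η⟯ := IsCyclotomicExtension.finiteDimensional {p ^ N} K _
  have : IsGalois K K⟮η⟯ := IsCyclotomicExtension.isGalois {p ^ N} K _
  have : NumberField K⟮η⟯ := NumberField.of_module_finite K K⟮η⟯
  let φ : layer p K L n →ₐ[K] K⟮η⟯ :=
    (inclusion hle).comp (equivMap (layer p K L n) f).toAlgHom
  let _ : Algebra (layer p K L n) K⟮η⟯ := φ.toRingHom.toAlgebra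
  have : IsScalarTower K (layer p K L n) K⟮η⟯ :=
    IsScalarTower.of_algebraMap_eq fun x => (φ.commutes x).symm
  obtain ⟨Q, hQ, hQP⟩ := (inferInstance : Nonempty (P.primesOver (𝓞 K⟮η⟯)))
  have : Q.LiesOver q := Ideal.LiesOver.trans Q P q
  have h1 : Q.ramificationIdx (𝓞 K) = 1 :=
    ramificationIdx_eq_one_of_isPrimitiveRoot p N (ζ := AdjoinSimple.gen K η)
      (Subtype.ext hη.pow_eq_one) (by
        apply lift_injective
        rw [lift_adjoin_simple, lift_top, AdjoinSimple.coe_gen]) q Q hq hpq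
  exact Nat.dvd_one.1 (h1 ▸ Ideal.ramificationIdx_below_dvd (R := 𝓞 K) P Q)

end LayerCyclotomic

/-! ### Norms of classes of primes above `p` and of extended ideals. -/

section Norms

theorem classNorm_mem_primeClasses (p : ℕ) {F E : Type*} [Field F] [NumberField F] [Field E]
    [NumberField E] [Algebra F E] {c : ClassGroup (𝓞 E)} (hc : c ∈ primeClasses p E) :
    classNorm F E c ∈ primeClasses p F := by
  have : primeClasses p E ≤ (primeClasses p F).comap (classNorm F E) := by
    refine (Subgroup.closure_le _).2 ?_
    rintro _ ⟨P, hP, hp, rfl⟩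
    have hP0 : (P : Ideal (𝓞 E)) ≠ ⊥ := mem_nonZeroDivisors_iff_ne_zero.1 P.2
    obtain ⟨s, hs⟩ := Ideal.exists_relNorm_eq_pow_of_isPrime (P : Ideal (𝓞 E))
      ((P : Ideal (𝓞 E)).under (𝓞 F))
    rw [SetLike.mem_coe, Subgroup.mem_comap, classNorm_mk0]
    have hq0 : (P : Ideal (𝓞 E)).under (𝓞 F) ≠ ⊥ := Ideal.IsIntegral.comap_ne_bot (𝓞 F) hP0
    let q : (Ideal (𝓞 F))⁰ := ⟨_, mem_nonZeroDivisors_iff_ne_zero.2 hq0⟩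
    have hq : ClassGroup.mk0 q ∈ primeClasses p F :=
      Subgroup.subset_closure ⟨q, inferInstanceAs ((P : Ideal (𝓞 E)).under (𝓞 F)).IsPrime, by
        change algebraMap (𝓞 F) (𝓞 E) (p : 𝓞 F) ∈ (P : Ideal (𝓞 E))
        rwa [map_natCast], rfl⟩
    convert pow_mem hq s
    rw [← map_pow]
    congr 1
    exact Subtype.ext hs
  exact this hc

/-- Descending from a high layer thus raises a class coming from `K` to a high power of `p`. -/
theorem classNorm_mk0_map {K F E : Type*} [Field K] [NumberField K] [Field F] [NumberField F]
    [Field E] [NumberField E] [Algebra K F] [Algebra K E] [Algebra F E] [IsScalarTower K F E]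
    (I : Ideal (𝓞 K)) (M : (Ideal (𝓞 E))⁰) (N : (Ideal (𝓞 F))⁰)
    (hM : (M : Ideal (𝓞 E)) = I.map (algebraMap (𝓞 K) (𝓞 E)))
    (hN : (N : Ideal (𝓞 F)) = I.map (algebraMap (𝓞 K) (𝓞 F))) :
    classNorm F E (ClassGroup.mk0 M) = ClassGroup.mk0 N ^ Module.finrank F E := by
  rw [classNorm_mk0, ← map_pow]
  congr 1
  apply Subtype.ext
  rw [SubmonoidClass.coe_pow, hN, IsFractionRing.finrank_eq (𝓞 F) F (𝓞 E) E,
    ← Ideal.relNorm_algebraMap' (𝓞 F) (S := 𝓞 E) I, ← hM]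

theorem mk0_pow_card_eq_one {K E : Type*} [Field K] [NumberField K] [Field E] [NumberField E]
    [Algebra K E] (I : Ideal (𝓞 K)) (hI : I ≠ ⊥) (N : (Ideal (𝓞 E))⁰)
    (hN : (N : Ideal (𝓞 E)) = I.map (algebraMap (𝓞 K) (𝓞 E))) :
    ClassGroup.mk0 N ^ Nat.card (ClassGroup (𝓞 K)) = 1 := by
  have h1 : ClassGroup.mk0 (⟨I, mem_nonZeroDivisors_iff_ne_zero.2 hI⟩ : (Ideal (𝓞 K))⁰) ^
    Nat.card (ClassGroup (𝓞 K)) = 1 := pow_card_eq_one'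
  rw [← map_pow, ClassGroup.mk0_eq_one_iff, SubmonoidClass.coe_pow] at h1 ⊢
  obtain ⟨x, hx⟩ := h1
  refine ⟨algebraMap (𝓞 K) (𝓞 E) x, ?_⟩
  change I ^ _ = Ideal.span {x} at hx
  rw [hN, ← Ideal.map_pow, hx, Ideal.map_span, Set.image_singleton]

end Norms

/-! ### Conjugation and `T` on `A`, and the invariance of primes above `p`. -/

section Action

variable {p : ℕ} [Fact p.Prime] {K L : Type*} [Field K] [NumberField K] [Field L] [Algebra K L]
  [IsCyclotomicZpExtension p K L]

theorem finrank_layer_layer {n m : ℕ} (h : n ≤ m) :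
    letI : Algebra (layer p K L n) (layer p K L m) :=
      (IntermediateField.inclusion (layer_mono p K L h)).toRingHom.toAlgebra
    Module.finrank (layer p K L n) (layer p K L m) = p ^ (m - n) := by
  let _ : Algebra (layer p K L n) (layer p K L m) :=
    (IntermediateField.inclusion (layer_mono p K L h)).toRingHom.toAlgebra
  have : IsScalarTower K (layer p K L n) (layer p K L m) :=
    IsScalarTower.of_algebraMap_eq fun _ => rfl
  apply Nat.eq_of_mul_eq_mul_left (pow_pos (Fact.out : p.Prime).pos n)
  rw [← pow_add, Nat.add_sub_cancel' h]
  have h1 := Module.finrank_mul_finrank K (layer p K L n) (layer p K L m)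
  rwa [finrank_layer, finrank_layer] at h1

theorem ext_A {a b : A p K L}
    (h : ∀ n, Additive.toMul (a.1 n : Cl p K L n) = Additive.toMul (b.1 n : Cl p K L n)) :
    a = b :=
  Subtype.ext (funext fun n => Subtype.ext (h n))

theorem toMul_act (σ : L ≃+* L) (hσ : ∀ n x, x ∈ layer p K L n ↔ σ x ∈ layer p K L n)
    (a : A p K L) (n : ℕ) :
    Additive.toMul ((act σ hσ a).1 n : Cl p K L n) =
      classMap (σ.restrict (layer p K L n) (layer p K L n) (hσ n))
        (Additive.toMul (a.1 n : Cl p K L n)) := rfl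

theorem act_act (σ ρ : L ≃+* L) (hσ : ∀ n x, x ∈ layer p K L n ↔ σ x ∈ layer p K L n)
    (hρ : ∀ n x, x ∈ layer p K L n ↔ ρ x ∈ layer p K L n) (a : A p K L) :
    act ρ hρ (act σ hσ a) =
      act (σ.trans ρ) (fun n x => (hσ n x).trans (hρ n (σ x))) a := by
  apply ext_A
  intro n
  rw [toMul_act, toMul_act, toMul_act, ← classMap_trans]
  rfl

theorem act_eq_self (hσ : ∀ n x, x ∈ layer p K L n ↔ RingEquiv.refl L x ∈ layer p K L n)
    (a : A p K L) : act (RingEquiv.refl L) hσ a = a := by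
  apply ext_A
  intro n
  rw [toMul_act]
  exact classMap_refl _

theorem galois_complexConj [IsCMField K] (σ : Gal(L/K)) (x : L) :
    σ (complexConj p K L x) = complexConj p K L (σ x) := by
  obtain ⟨φ₀⟩ := nonempty_embedding p K L
  apply φ₀.injective
  rw [complexConj_spec]
  exact complexConj_spec p K L (φ₀.comp (σ : L →+* L)) x

theorem complexConj_complexConj [IsCMField K] (x : L) :
    complexConj p K L (complexConj p K L x) = x := by
  obtain ⟨φ₀⟩ := nonempty_embedding p K L
  apply φ₀.injective
  rw [complexConj_spec, complexConj_spec, Complex.conj_conj]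

theorem complexConj_algebraMap [IsCMField K] (x : K) :
    complexConj p K L (algebraMap K L x) = algebraMap K L (IsCMField.complexConj K x) := by
  obtain ⟨φ₀⟩ := nonempty_embedding p K L
  apply φ₀.injective
  rw [complexConj_spec]
  exact (IsCMField.complexEmbedding_complexConj K (φ₀.comp (algebraMap K L)) x).symm

theorem act_complexConj_act_complexConj [IsCMField K] (a : A p K L) :
    act (complexConj p K L) (complexConj_mem_layer p K L)
      (act (complexConj p K L) (complexConj_mem_layer p K L) a) = a := by
  rw [act_act]
  have h : (complexConj p K L).trans (complexConj p K L) = RingEquiv.refl L :=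
    RingEquiv.ext complexConj_complexConj
  simp only [h]
  exact act_eq_self _ a

theorem act_complexConj_T [IsCMField K] (τ : Gal(L/K)) (a : A p K L) :
    act (complexConj p K L) (complexConj_mem_layer p K L) (T p τ a) =
      T p τ (act (complexConj p K L) (complexConj_mem_layer p K L) a) := by
  have h : τ.toRingEquiv.trans (complexConj p K L) = (complexConj p K L).trans τ.toRingEquiv :=
    RingEquiv.ext fun x => (galois_complexConj τ x).symm
  simp only [T, LinearMap.sub_apply, map_sub, act_act, h, LinearMap.id_apply]

theorem act_complexConj_of_mem_AMinus [IsCMField K] {a : A p K L} (ha : a ∈ AMinus p K L) :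
    act (complexConj p K L) (complexConj_mem_layer p K L) a = -a := by
  obtain ⟨b, rfl⟩ := ha
  simp [oneSubConj, act_complexConj_act_complexConj]

/-- Distinct primes of a layer above `p` lie above distinct primes of `K`. -/
theorem eq_of_map_under_le (hram : IsTotallyRamifiedAbove p K L) {n : ℕ}
    {P P' : Ideal (𝓞 (layer p K L n))} [P.IsPrime] [P'.IsPrime]
    (hp : (p : 𝓞 (layer p K L n)) ∈ P)
    (h : (P.under (𝓞 K)).map (algebraMap (𝓞 K) (𝓞 (layer p K L n))) ≤ P') : P = P' := by
  have hpq : (p : 𝓞 K) ∈ P.under (𝓞 K) := by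
    change algebraMap (𝓞 K) (𝓞 (layer p K L n)) (p : 𝓞 K) ∈ P
    rwa [map_natCast]
  obtain ⟨Q, hQ, hQq⟩ := hram n (P.under (𝓞 K)) inferInstance hpq
  have hp0 : (p : 𝓞 (layer p K L n)) ≠ 0 :=
    Nat.cast_ne_zero.2 (Fact.out : p.Prime).ne_zero
  have hpQ : (p : 𝓞 (layer p K L n)) ∈ Q := by
    have h1 := Ideal.mem_map_of_mem (algebraMap (𝓞 K) (𝓞 (layer p K L n))) hpq
    rw [map_natCast, hQq] at h1
    exact Ideal.pow_le_self Module.finrank_pos.ne' h1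
  have hQ0 : Q ≠ ⊥ := fun h1 => hp0 (by rwa [h1, Ideal.mem_bot] at hpQ)
  have hQmax : Q.IsMaximal := Ring.DimensionLEOne.maximalOfPrime hQ0 hQ
  rw [hQq] at h
  have h2 : Q ^ Module.finrank K (layer p K L n) ≤ P := hQq ▸ Ideal.map_comap_le
  rw [← hQmax.eq_of_le (Ideal.IsPrime.ne_top inferInstance) (Ideal.IsPrime.le_of_pow_le h2),
    ← hQmax.eq_of_le (Ideal.IsPrime.ne_top inferInstance) (Ideal.IsPrime.le_of_pow_le h)]

open scoped Pointwise in
-- `P` and `g • P` lie above the same prime of `K`, and total ramification leaves only one prime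
-- there.
theorem smul_eq_of_mem (hram : IsTotallyRamifiedAbove p K L) {n : ℕ} (g : Gal(layer p K L n/K))
    (P : Ideal (𝓞 (layer p K L n))) [P.IsPrime] (hp : (p : 𝓞 (layer p K L n)) ∈ P) :
    g • P = P := by
  have := layer_isGalois p K L n
  refine (eq_of_map_under_le hram hp ?_).symm
  rw [Ideal.map_le_iff_le_comap]
  intro x hx
  have h1 : g • algebraMap (𝓞 K) (𝓞 (layer p K L n)) x ∈ g • P :=
    Ideal.smul_mem_pointwise_smul _ _ _ hx
  rwa [smul_algebraMap] at h1

theorem classMap_restrict_eq_of_mem_primeClasses (hram : IsTotallyRamifiedAbove p K L)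
    (τ : Gal(L/K)) {n : ℕ} {c : ClassGroup (𝓞 (layer p K L n))}
    (hc : c ∈ primeClasses p (layer p K L n)) :
    classMap (τ.toRingEquiv.restrict (layer p K L n) (layer p K L n)
      (galois_mem_layer p K L τ n)) c = c := by
  have := layer_isGalois p K L n
  rw [restrict_eq_restrictNormal]
  induction hc using Subgroup.closure_induction with
  | mem c hc =>
    obtain ⟨P, hP, hp, rfl⟩ := hc
    rw [classMap_mk0]
    congr 1
    exact Subtype.ext (smul_eq_of_mem hram _ _ hp)
  | one => exact map_one _
  | mul x y _ _ hx hy => rw [map_mul, hx, hy]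
  | inv x _ hx => rw [map_inv, hx]

theorem T_eq_zero_of_mem_B (hram : IsTotallyRamifiedAbove p K L) (τ : Gal(L/K)) {a : A p K L}
    (ha : a ∈ B p K L) : T p τ a = 0 := by
  rw [T, LinearMap.sub_apply, LinearMap.id_apply, sub_eq_zero]
  exact ext_A fun n => classMap_restrict_eq_of_mem_primeClasses hram τ (ha n)

end Action

/-! ### The kernel of `T` on the minus part, and the injection. -/

section Main

theorem exists_injective_comp_eq {R M N P : Type*} [Ring R] [AddCommGroup M] [AddCommGroup N]
    [AddCommGroup P] [Module R M] [Module R N] [Module R P] (g : M →ₗ[R] N)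
    (hg : Function.Surjective g) (f : M →ₗ[R] P) (h : LinearMap.ker g = LinearMap.ker f) :
    ∃ F : N →ₗ[R] P, Function.Injective F ∧ ∀ a, F (g a) = f a := by
  let e := g.quotKerEquivOfSurjective hg
  let F : N →ₗ[R] P := (LinearMap.ker g).liftQ f h.le ∘ₗ e.symm.toLinearMap
  have hF : ∀ a, F (g a) = f a := by
    intro a
    have h1 : e.symm (g a) = Submodule.Quotient.mk a := e.symm_apply_eq.2 rfl
    change (LinearMap.ker g).liftQ f h.le (e.symm (g a)) = _
    rw [h1]
    rfl
  refine ⟨F, ?_, hF⟩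
  rw [injective_iff_map_eq_zero]
  intro x hx
  obtain ⟨a, rfl⟩ := hg x
  rw [hF] at hx
  exact LinearMap.mem_ker.1 (h.ge hx)

theorem mem_of_pow_mem_of_coprime {G : Type*} [Group G] {H : Subgroup G} {c : G} {r s : ℕ}
    (hrs : Nat.Coprime r s) (hr : c ^ r ∈ H) (hs : c ^ s = 1) : c ∈ H := by
  have h := Nat.gcd_eq_gcd_ab r s
  rw [hrs.gcd_eq_one] at h
  rw [← zpow_one c, ← Nat.cast_one, h, zpow_add, zpow_mul, zpow_mul, zpow_natCast, zpow_natCast, hs,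
    one_zpow, mul_one]
  exact zpow_mem hr _

variable {p : ℕ} [Fact p.Prime] {K L : Type*} [Field K] [NumberField K] [Field L] [Algebra K L]
  [IsCyclotomicZpExtension p K L] [IsCMField K]

/-- The component of `a` at layer `n` is the norm of its component at layer `n + s`, to which the
ambiguous class argument applies. The norm turns the part extended from `K` into a `p ^ s`-th power,
of order prime to `p`. -/
theorem mem_B_of_T_eq_zero (hp : p ≠ 2) (hram : IsTotallyRamifiedAbove p K L) {τ : Gal(L/K)}
    (hτ : (Subgroup.zpowers τ).topologicalClosure = ⊤) {a : A p K L} (ha : a ∈ AMinus p K L)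
    (hT : T p τ a = 0) : a ∈ B p K L := by
  have hpp : p.Prime := Fact.out
  intro n
  -- `p ^ s` is the exact power of `p` in the class number of `K`. Climbing `s` layers is what kills
  -- the `p`-part of the extended class.
  obtain ⟨s, h', hh', hcard⟩ := Nat.exists_eq_pow_mul_and_not_dvd
    (Nat.card_pos (α := ClassGroup (𝓞 K))).ne' p hpp.ne_one
  let m := n + s
  have hnm : n ≤ m := Nat.le_add_right n s
  have := layer_isGalois p K L m
  let _ : Algebra (layer p K L n) (layer p K L m) :=
    (IntermediateField.inclusion (layer_mono p K L hnm)).toRingHom.toAlgebra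
  have : IsScalarTower K (layer p K L n) (layer p K L m) :=
    IsScalarTower.of_algebraMap_eq fun _ => rfl
  set c : ClassGroup (𝓞 (layer p K L m)) := Additive.toMul (a.1 m : Cl p K L m) with hc
  have hgc : classMap (AlgEquiv.restrictNormalHom (layer p K L m) τ).toRingEquiv c = c := by
    rw [T, LinearMap.sub_apply, LinearMap.id_apply, sub_eq_zero] at hT
    rw [← restrict_eq_restrictNormal, hc, ← toMul_act, hT]
  have hjc : classMap ((complexConj p K L).restrict (layer p K L m) (layer p K L m)
      (complexConj_mem_layer p K L m)) c = c⁻¹ := by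
    rw [hc, ← toMul_act, act_complexConj_of_mem_AMinus ha]
    rfl
  obtain ⟨w, hw, b, hb, I, hI, M, hM, hcM⟩ := exists_pow_eq_mul_of_classMap_eq p
    (AlgEquiv.restrictNormalHom (layer p K L m) τ) (mem_zpowers_restrictNormal p hτ m)
    (fun q P _ hq hpq _ _ => layer_ramificationIdx_eq_one p K L m q P hq hpq)
    (fun P _ hP => smul_eq_of_mem hram _ P hP)
    (fun ζ hζ => exists_units_norm_eq p K L hp m hζ)
    (IsCMField.complexConj K : K ≃+* K)
    (fun φ x => IsCMField.complexEmbedding_complexConj K φ x)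
    ((complexConj p K L).restrict (layer p K L m) (layer p K L m) (complexConj_mem_layer p K L m))
    (fun x => Subtype.ext (complexConj_algebraMap x))
    (fun x => Subtype.ext (by
      change complexConj p K L (AlgEquiv.restrictNormalHom (layer p K L m) τ x : L) =
        algebraMap (layer p K L m) L (AlgEquiv.restrictNormal τ (layer p K L m) _)
      rw [AlgEquiv.restrictNormal_commutes]
      refine Eq.trans ?_ (galois_complexConj τ _).symm
      congr 1
      exact AlgEquiv.restrictNormal_commutes τ (layer p K L m) x))
    c hgc hjc
  have hN0 : I.map (algebraMap (𝓞 K) (𝓞 (layer p K L n))) ≠ ⊥ := Ideal.map_ne_bot_of_ne_bot hI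
  let N : (Ideal (𝓞 (layer p K L n)))⁰ := ⟨_, mem_nonZeroDivisors_iff_ne_zero.2 hN0⟩
  have hnorm : classNorm (layer p K L n) (layer p K L m) c =
      Additive.toMul (a.1 n : Cl p K L n) :=
    congrArg (fun z : PPart p (Cl p K L n) => Additive.toMul (z : Cl p K L n)) (a.2 n m hnm)
  set d : ClassGroup (𝓞 (layer p K L n)) := Additive.toMul (a.1 n : Cl p K L n) with hd
  have hrank : Module.finrank (layer p K L n) (layer p K L m) = p ^ s := by
    rw [finrank_layer_layer hnm, Nat.add_sub_cancel_left]
  have hdN : d ^ (2 * w) = classNorm (layer p K L n) (layer p K L m) b *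
      ClassGroup.mk0 N ^ p ^ s := by
    rw [← hnorm, ← map_pow, hcM, map_mul, classNorm_mk0_map I M N hM rfl, hrank]
  have hmem : d ^ (2 * w * h') ∈ primeClasses p (layer p K L n) := by
    rw [pow_mul, hdN, mul_pow, ← pow_mul, ← hcard, mk0_pow_card_eq_one I hI N rfl, mul_one]
    exact pow_mem (classNorm_mem_primeClasses p hb) _
  obtain ⟨k, hk⟩ := (a.1 n).2
  have hdk : d ^ p ^ k = 1 := hk
  -- The exponent `2 * w * h'` is prime to `p`, while `d` has `p`-power order, so the exponent can
  -- be removed.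
  refine mem_of_pow_mem_of_coprime (r := 2 * w * h') (s := p ^ k) ?_ hmem hdk
  refine Nat.Coprime.symm (Nat.Coprime.pow_left _ ?_)
  exact ((((Nat.coprime_primes hpp Nat.prime_two).2 hp).mul_right hw).mul_right
    (hpp.coprime_iff_not_dvd.2 hh'))

/-- Since 2 is a unit of `ℤ_p` for odd `p`, one has `a = (1 - j)(a / 2)`. -/
theorem mem_BMinus_of_mem_B (hp : p ≠ 2) {a : A p K L} (ha : a ∈ B p K L)
    (hja : act (complexConj p K L) (complexConj_mem_layer p K L) a = -a) : a ∈ BMinus p K L := by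
  have h2 : IsUnit (2 : ℤ_[p]) := by
    by_contra h
    rw [PadicInt.not_isUnit_iff] at h
    have h1 : (p : ℤ) ∣ (2 : ℕ) := (PadicInt.norm_int_lt_one_iff_dvd _).1 (by exact_mod_cast h)
    exact hp ((Nat.prime_dvd_prime_iff_eq Fact.out Nat.prime_two).1 (Int.natCast_dvd_natCast.1 h1))
  obtain ⟨u, hu⟩ := h2.exists_right_inv
  refine ⟨u • a, (B p K L).smul_mem u ha, ?_⟩
  rw [oneSubConj, LinearMap.sub_apply, LinearMap.id_apply, map_smul, hja, smul_neg, sub_neg_eq_add,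
    ← add_smul, ← two_mul, hu, one_smul]

/-- The elements of `A^-` whose class modulo `B` is killed by `T`. -/
noncomputable def torsionLift (p : ℕ) [Fact p.Prime] {K L : Type*} [Field K] [NumberField K]
    [Field L] [Algebra K L] [IsCyclotomicZpExtension p K L] [IsCMField K] (τ : Gal(L/K)) :
    Submodule ℤ_[p] (A p K L) :=
  AMinus p K L ⊓ (A'MinusTorsion p τ).comap (B p K L).mkQ

theorem T_mem_B {τ : Gal(L/K)} {a : A p K L} (ha : a ∈ torsionLift p τ) : T p τ a ∈ B p K L := by
  have h : T' p τ ((B p K L).mkQ a) = 0 := ha.2.2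
  exact (Submodule.Quotient.mk_eq_zero _).1 h

theorem T_mem_BMinus (hp : p ≠ 2) {τ : Gal(L/K)} {a : A p K L} (ha : a ∈ torsionLift p τ) :
    T p τ a ∈ BMinus p K L := by
  refine mem_BMinus_of_mem_B hp (T_mem_B ha) ?_
  rw [act_complexConj_T, act_complexConj_of_mem_AMinus ha.1, map_neg]

variable (p) in
/-- The reduction modulo `B` from the preimage of `(A')^-[T]` in `A^-` to `(A')^-[T]`. -/
noncomputable def torsionLiftMkQ (τ : Gal(L/K)) :
    torsionLift p τ →ₗ[ℤ_[p]] A'MinusTorsion p τ :=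
  ((B p K L).mkQ ∘ₗ (torsionLift p τ).subtype).codRestrict _ fun a => a.2.2

theorem torsionLiftMkQ_surjective (τ : Gal(L/K)) : Function.Surjective (torsionLiftMkQ p τ) := by
  rintro ⟨x, hx⟩
  obtain ⟨y, hy⟩ := hx.1
  obtain ⟨b, rfl⟩ := (B p K L).mkQ_surjective y
  -- An arbitrary lift of `x` need not lie in `A^-`. Writing `x` as `1 - j` applied to the class of
  -- `b` supplies the lift `(1 - j) b`, which does.
  refine ⟨⟨oneSubConj p K L b, ⟨b, rfl⟩, ?_⟩, Subtype.ext hy⟩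
  change (B p K L).mkQ (oneSubConj p K L b) ∈ A'MinusTorsion p τ
  have : (B p K L).mkQ (oneSubConj p K L b) = x := hy
  rwa [this]

/-- Both kernels consist of the elements lying in `B`: one inclusion is the invariance of primes
above `p`, the other the ambiguous class argument. -/
theorem ker_torsionLiftMkQ (hp : p ≠ 2) (hram : IsTotallyRamifiedAbove p K L) {τ : Gal(L/K)}
    (hτ : (Subgroup.zpowers τ).topologicalClosure = ⊤) :
    LinearMap.ker (torsionLiftMkQ p τ) =
      LinearMap.ker (T p τ ∘ₗ (torsionLift p τ).subtype) := by
  ext a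
  have h1 : a ∈ LinearMap.ker (torsionLiftMkQ p τ) ↔ (a : A p K L) ∈ B p K L := by
    rw [LinearMap.mem_ker, Subtype.ext_iff]
    exact Submodule.Quotient.mk_eq_zero _
  rw [h1]
  exact ⟨fun h => T_eq_zero_of_mem_B hram τ h, fun h => mem_B_of_T_eq_zero hp hram hτ a.2.1 h⟩

end Main

end Iwasawa

theorem lemma2 (p : ℕ) [Fact p.Prime] (hp : p ≠ 2)
    (K L : Type*) [Field K] [NumberField K] [NumberField.IsCMField K] [Field L] [Algebra K L]
    [Iwasawa.IsCyclotomicZpExtension p K L]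
    (hram : Iwasawa.IsTotallyRamifiedAbove p K L)
    (τ : Gal(L/K)) (hτ : (Subgroup.zpowers τ).topologicalClosure = ⊤)
    (hT : Iwasawa.A'MinusPart p τ ≠ ⊥) :
    Iwasawa.B' p τ ≤ Iwasawa.BMinus p K L ∧
    Nonempty (Iwasawa.B' p τ ≃ₗ[ℤ_[p]] Iwasawa.A'MinusTorsion p τ) ∧
    ∃ That : Iwasawa.A'MinusTorsion p τ →ₗ[ℤ_[p]] Iwasawa.BMinus p K L,
      Function.Injective That ∧
      ∀ a ∈ Iwasawa.AMinus p K L,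
        ∀ h : (Iwasawa.B p K L).mkQ a ∈ Iwasawa.A'MinusTorsion p τ,
          (That ⟨(Iwasawa.B p K L).mkQ a, h⟩ : Iwasawa.A p K L) = Iwasawa.T p τ a := by
  have hB' : Iwasawa.B' p τ ≤ Iwasawa.BMinus p K L := by
    rintro _ ⟨a, ha, rfl⟩
    exact Iwasawa.T_mem_BMinus hp ha
  obtain ⟨F, hinj, hF⟩ := Iwasawa.exists_injective_comp_eq (M := Iwasawa.torsionLift p τ)
    (N := Iwasawa.A'MinusTorsion p τ) (Iwasawa.torsionLiftMkQ p τ)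
    (Iwasawa.torsionLiftMkQ_surjective τ)
    (Iwasawa.T p τ ∘ₗ (Iwasawa.torsionLift p τ).subtype)
    (Iwasawa.ker_torsionLiftMkQ hp hram hτ)
  -- Reduction modulo `B` is onto, so `F` has the same image as `T` on the lifts, which is `B'`. The
  -- isomorphism is the inverse of `F` onto this image.
  have hrange : LinearMap.range F = Iwasawa.B' p τ := by
    apply le_antisymm
    · rintro _ ⟨x, rfl⟩
      obtain ⟨a, rfl⟩ := Iwasawa.torsionLiftMkQ_surjective τ x
      exact ⟨a, a.2, (hF a).symm⟩
    · rintro _ ⟨a, ha, rfl⟩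
      exact ⟨_, hF ⟨a, ha⟩⟩
  refine ⟨hB', ⟨((LinearEquiv.ofInjective F hinj).trans (LinearEquiv.ofEq _ _ hrange)).symm⟩,
    F.codRestrict _ fun x => hB' (hrange ▸ LinearMap.mem_range_self F x),
    fun x y hxy => hinj (congrArg Subtype.val hxy), fun a ha h => hF ⟨a, ha, h⟩⟩
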